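/- Let $n,m\in\mathbb Z_{\ge 0}$ and put $|z|^2=|z_1|^2+\dots+|z_n|^2$, $|p|=p_1+\dots+p_n$, $p!=p_1!\cdots p_n!$. **Spaces.** Let $\nu_m$ be the measure on $\mathbb P^n(\mathbb C)$ which in the affine chart $z\mapsto[1:z_1:\dots:z_n]$ is $$d\nu_m(z)=\frac{(n+m)!}{\pi^n\,m!}\,\frac{dV(z)}{(1+|z|^2)^{n+m+1}},$$ where $dV$ is Lebesgue measure on $\mathbb C^n$; sections of $H^m$, where $H$ is the hyperplane line bundle, are identified with functions by the trivialization over $\{w_0\neq0\}$ given by the frame $w/w_0$ of the tautological bundle. Let $\mathcal A^2_m(\mathbb P^n(\mathbb C))\subset L_2(\mathbb P^n(\mathbb C),\nu_m)$ be the subspace of the global holomorphic sections of $H^m$ (the Bergman space). The Bergman projection $B_m$ is the orthogonal projection of $L_2(\mathbb P^n(\mathbb C),\nu_m)$ onto $\mathcal A^2_m(\mathbb P^n(\mathbb C))$; it is given by $B_m\psi(z)=\int_{\mathbb C^n}\psi(w)\,(1+z_1\overline{w}_1+\dots+z_n\overline{w}_n)^m\,d\nu_m(w)$. Let $\mu_m$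 be the measure $$d\mu_m(r)=2^n\,\frac{(n+m)!}{m!}\,\frac{r_1\,dr_1\cdots r_n\,dr_n}{(1+r_1^2+\dots+r_n^2)^{n+m+1}}$$ on $\mathbb R^n_+=(0,\infty)^n$. Let $J_n(m)=\{p\in\mathbb Z_{\ge0}^n:|p|\le m\}$. **Operators.** Let $U:L_2(\mathbb P^n(\mathbb C),\nu_m)\to l_2(\mathbb Z^n)\otimes L_2(\mathbb R^n_+,\mu_m)$ be the Fourier transform in the angular variables, $$(U\psi)_p(r)=\int_{\mathbb T^n}\psi(t_1r_1,\dots,t_nr_n)\,t^{-p}\prod_{j=1}^n\frac{dt_j}{2\pi i t_j},\qquad p\in\mathbb Z^n,$$ let $R_0:l_2(J_n(m))\to l_2(\mathbb Z^n)\otimes L_2(\mathbb R^n_+,\mu_m)$ be given by $$(R_0c)_p(r)=\left(\frac{m!}{p!\,(m-|p|)!}\right)^{1/2}c_p\,r^p\ \ (p\in J_n(m)),\qquad (R_0c)_p=0\ \ (p\in\mathbb Z^n\setminus J_n(m)),$$ and put $R=R_0^*U$. **Theorem.** 1. $R$ maps $L_2(\mathbb P^n(\mathbb C),\nu_m)$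 onto $l_2(J_n(m))$, and its restriction $R|_{\mathcal A^2_m(\mathbb P^n(\mathbb C))}:\mathcal A^2_m(\mathbb P^n(\mathbb C))\to l_2(J_n(m))$ is an isometric isomorphism. 2. The adjoint $R^*=U^*R_0$ is an isometric isomorphism of $l_2(J_n(m))$ onto the subspace $\mathcal A^2_m(\mathbb P^n(\mathbb C))$ of $L_2(\mathbb P^n(\mathbb C),\nu_m)$. 3. $RR^*=I$ on $l_2(J_n(m))$, and $R^*R=B_m$ is the Bergman projection of $L_2(\mathbb P^n(\mathbb C),\nu_m)$ onto $\mathcal A^2_m(\mathbb P^n(\mathbb C))$. -/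

import Mathlib

open MeasureTheory Set
open scoped ENNReal

namespace SepRadial
noncomputable section

/-- Complex projective space of dimension `n`. -/
abbrev PC (n : ℕ) : Type := Projectivization ℂ (Fin (n + 1) → ℂ)

/-- The quotient topology of the space of nonzero vectors. -/
instance (n : ℕ) : TopologicalSpace (PC n) :=
  TopologicalSpace.coinduced (Projectivization.mk' (V := Fin (n + 1) → ℂ) ℂ) inferInstance

instance (n : ℕ) : MeasurableSpace (PC n) := borel (PC n)

instance (n : ℕ) : BorelSpace (PC n) := ⟨rfl⟩

theorem insertOne_ne_zero {n : ℕ} (j : Fin (n + 1)) (z : Fin n → ℂ) :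
    (j.insertNth (1 : ℂ) z : Fin (n + 1) → ℂ) ≠ 0 := fun h => by
  simpa using congrFun h j

/-- The inverse of the affine chart on the open set where the `j`-th homogeneous coordinate is
nonzero: the point whose homogeneous coordinates are those of `z` with `1` inserted at place `j`. -/
def chartInv {n : ℕ} (j : Fin (n + 1)) (z : Fin n → ℂ) : PC n :=
  Projectivization.mk ℂ (j.insertNth (1 : ℂ) z) (insertOne_ne_zero j z)

theorem continuous_chartInv {n : ℕ} (j : Fin (n + 1)) : Continuous (chartInv (n := n) j) := by
  have h1 : Continuous fun z : Fin n → ℂ =>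
      (⟨j.insertNth (1 : ℂ) z, insertOne_ne_zero j z⟩ : {v : Fin (n + 1) → ℂ // v ≠ 0}) := by
    refine Continuous.subtype_mk ?_ _
    exact continuous_const.finInsertNth j continuous_id
  exact continuous_coinduced_rng.comp h1

/-- The weighted measure in the affine chart `0`: density
`(n+m)! / (π^n m!) * (1 + |z|^2)^(-(n+m+1))` with respect to Lebesgue measure on `ℂ^n`. -/
def nuAffine (n m : ℕ) : Measure (Fin n → ℂ) :=
  volume.withDensity fun z => ENNReal.ofReal
    (((n + m).factorial : ℝ) / (Real.pi ^ n * (m.factorial : ℝ)) /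
      (1 + ∑ k, ‖z k‖ ^ 2) ^ (n + m + 1))

/-- The weighted measure on projective space. It is carried by the image of the affine chart `0`,
whose complement has Fubini-Study volume zero. -/
def nu (n m : ℕ) : Measure (PC n) := (nuAffine n m).map (chartInv 0)

theorem measurePreserving_chartInv (n m : ℕ) :
    MeasurePreserving (chartInv 0) (nuAffine n m) (nu n m) :=
  ⟨(continuous_chartInv 0).measurable, rfl⟩

/-- Expression of an element of `L_2(P^n(ℂ), ν_m)` in the affine chart `0`. -/
def Phi (n m : ℕ) : Lp ℂ 2 (nu n m) →ₗᵢ[ℂ] Lp ℂ 2 (nuAffine n m) :=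
  Lp.compMeasurePreservingₗᵢ ℂ (chartInv 0) (measurePreserving_chartInv n m)

/-- The fibre over the line `ℓ` of the `m`-th power of the hyperplane bundle, which is the dual of
the tautological bundle: `m`-linear forms on the line `ℓ`. -/
abbrev HFiber {n : ℕ} (m : ℕ) (ℓ : PC n) : Type :=
  MultilinearMap ℂ (fun _ : Fin m => ℓ.submodule) ℂ

theorem insertOne_mem {n : ℕ} (j : Fin (n + 1)) (z : Fin n → ℂ) :
    (j.insertNth (1 : ℂ) z : Fin (n + 1) → ℂ) ∈ (chartInv j z).submodule := by
  simp [chartInv, Projectivization.submodule_mk, Submodule.mem_span_singleton_self]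

/-- The local holomorphic frame `[w] ↦ w / w_j` of the tautological bundle, in the chart `j`. -/
def frame {n : ℕ} (j : Fin (n + 1)) (z : Fin n → ℂ) : (chartInv j z).submodule :=
  ⟨j.insertNth (1 : ℂ) z, insertOne_mem j z⟩

/-- A section of the `m`-th power of the hyperplane bundle in the `j`-th chart and trivialization.
On overlaps these satisfy `s_j = (w_k / w_j)^m s_k`. -/
def localForm {n m : ℕ} (ζ : ∀ ℓ : PC n, HFiber m ℓ) (j : Fin (n + 1)) (z : Fin n → ℂ) : ℂ :=
  ζ (chartInv j z) fun _ => frame j z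

/-- A global section is holomorphic if it is holomorphic in each standard chart and
trivialization. -/
def IsHolomorphicSection {n m : ℕ} (ζ : ∀ ℓ : PC n, HFiber m ℓ) : Prop :=
  ∀ j : Fin (n + 1), Differentiable ℂ (localForm ζ j)

/-- The Bergman space: the elements of `L_2(P^n(ℂ), ν_m)` that are given, in the chart and
trivialization over `w_0 ≠ 0`, by a global holomorphic section of the `m`-th power of the hyperplane
bundle. -/
def bergmanSpace (n m : ℕ) : Submodule ℂ (Lp ℂ 2 (nu n m)) where
  carrier := {f | ∃ ζ : ∀ ℓ : PC n, HFiber m ℓ, IsHolomorphicSection ζ ∧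
    Phi n m f =ᵐ[nuAffine n m] localForm ζ 0}
  add_mem' := by
    rintro f g ⟨ζ, hζ, hf⟩ ⟨ξ, hξ, hg⟩
    refine ⟨fun ℓ => ζ ℓ + ξ ℓ, fun j => (hζ j).add (hξ j), ?_⟩
    rw [map_add]
    filter_upwards [hf, hg, Lp.coeFn_add (Phi n m f) (Phi n m g)] with z h1 h2 h3
    rw [h3, Pi.add_apply, h1, h2]
    rfl
  zero_mem' := by
    refine ⟨fun ℓ => 0, fun j => differentiable_const (0 : ℂ), ?_⟩
    rw [map_zero]
    filter_upwards [Lp.coeFn_zero ℂ 2 (nuAffine n m)] with z h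
    rw [h]
    rfl
  smul_mem' := by
    rintro c f ⟨ζ, hζ, hf⟩
    refine ⟨fun ℓ => c • ζ ℓ, fun j => (hζ j).const_smul c, ?_⟩
    rw [map_smul]
    filter_upwards [hf, Lp.coeFn_smul c (Phi n m f)] with z h1 h2
    rw [h2, Pi.smul_apply, h1]
    rfl

/-- The normalized Haar measure on the torus; the torus is written additively, the point `θ` having
the coordinates `t_k = exp (2 π i θ_k)`. -/
def torusMeasure (n : ℕ) : Measure (UnitAddTorus (Fin n)) :=
  Measure.pi fun _ => AddCircle.haarAddCircle

instance (n : ℕ) : IsProbabilityMeasure (torusMeasure n) := by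
  unfold torusMeasure; infer_instance

/-- The radial measure on the positive orthant: `2^n (n+m)! / m! * (1 + |r|^2)^(-(n+m+1)) ∏ r_k dr_k`. -/
def mu (n m : ℕ) : Measure (Fin n → ℝ) :=
  (volume.restrict {r | ∀ k, 0 < r k}).withDensity fun r => ENNReal.ofReal
    (2 ^ n * ((n + m).factorial : ℝ) / (m.factorial : ℝ) /
      (1 + ∑ k, r k ^ 2) ^ (n + m + 1) * ∏ k, r k)

instance (n m : ℕ) : SFinite (mu n m) := by
  unfold mu; infer_instance

/-- Polar coordinates `(t, r) ↦ (t_1 r_1, ..., t_n r_n)`. -/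
def polarMap (n : ℕ) (x : UnitAddTorus (Fin n) × (Fin n → ℝ)) : Fin n → ℂ :=
  fun k => (AddCircle.toCircle (x.1 k) : ℂ) * (x.2 k : ℂ)

theorem continuous_polarMap (n : ℕ) : Continuous (polarMap n) := by
  unfold polarMap
  refine continuous_pi fun k => ?_
  have : Continuous fun x : UnitAddTorus (Fin n) × (Fin n → ℝ) => AddCircle.toCircle (x.1 k) :=
    AddCircle.continuous_toCircle.comp (by fun_prop)
  fun_prop

def angleMap (n : ℕ) (φ : Fin n → ℝ) : UnitAddTorus (Fin n) :=
  fun k => ((φ k / (2 * Real.pi) : ℝ) : UnitAddCircle)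

theorem angle_mp1 : MeasurePreserving (fun φ : ℝ => ((φ / (2 * Real.pi) : ℝ) : UnitAddCircle))
    (volume.restrict (Ioo (-Real.pi) Real.pi))
    (ENNReal.ofReal (2 * Real.pi) • AddCircle.haarAddCircle) := by
  have hpi : (0 : ℝ) < 2 * Real.pi := by positivity
  have h1 := UnitAddCircle.measurePreserving_mk (-1/2)
  have h2 : MeasurePreserving (fun φ : ℝ => φ / (2 * Real.pi))
      (volume.restrict (Ioo (-Real.pi) Real.pi))
      (ENNReal.ofReal (2 * Real.pi) • volume.restrict (Ioc (-1/2) (-1/2+1))) := by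
    refine ⟨by fun_prop, ?_⟩
    have e : (Ioo (-Real.pi) Real.pi) = (fun φ : ℝ => φ / (2 * Real.pi)) ⁻¹' (Ioo (-1/2) (1/2)) := by
      ext x
      simp only [mem_Ioo, mem_preimage, lt_div_iff₀ hpi, div_lt_iff₀ hpi]
      constructor <;> rintro ⟨h, h'⟩ <;> constructor <;> linarith
    rw [e, ← Measure.restrict_map (by fun_prop) measurableSet_Ioo]
    have := Real.smul_map_volume_mul_right (a := (2 * Real.pi)⁻¹) (by positivity)
    have h3 : Measure.map (fun φ : ℝ => φ / (2 * Real.pi)) volume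
        = ENNReal.ofReal (2 * Real.pi) • volume := by
      simp only [div_eq_mul_inv]
      rw [Real.map_volume_mul_right (by positivity), inv_inv, abs_of_pos hpi]
    rw [h3, Measure.restrict_smul]
    congr 1
    rw [show (-1/2+1 : ℝ) = 1/2 by norm_num]
    exact Measure.restrict_congr_set Ioo_ae_eq_Ioc
  have h3 : MeasurePreserving (fun x : ℝ => (x : UnitAddCircle))
      (ENNReal.ofReal (2 * Real.pi) • volume.restrict (Ioc (-1/2) (-1/2+1)))
      (ENNReal.ofReal (2 * Real.pi) • AddCircle.haarAddCircle) := by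
    refine ⟨h1.measurable, ?_⟩
    rw [Measure.map_smul, h1.map_eq, AddCircle.volume_eq_smul_haarAddCircle]
    simp
  exact h3.comp h2

theorem angle_mp (n : ℕ) : MeasurePreserving (angleMap n)
    (volume.restrict {φ : Fin n → ℝ | ∀ k, φ k ∈ Ioo (-Real.pi) Real.pi})
    (ENNReal.ofReal (2 * Real.pi) ^ n • torusMeasure n) := by
  have hfin : IsFiniteMeasure
      (ENNReal.ofReal (2 * Real.pi) • (AddCircle.haarAddCircle (T := 1))) :=
    Measure.smul_finite _ ENNReal.ofReal_ne_top
  have h := measurePreserving_pi (ι := Fin n) (fun _ => volume.restrict (Ioo (-Real.pi) Real.pi))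
    (fun _ => ENNReal.ofReal (2 * Real.pi) • (AddCircle.haarAddCircle (T := 1)))
    (fun _ => angle_mp1)
  rw [← Measure.restrict_pi_pi] at h
  have e1 : {φ : Fin n → ℝ | ∀ k, φ k ∈ Ioo (-Real.pi) Real.pi}
      = univ.pi fun _ => Ioo (-Real.pi) Real.pi := by
    ext; simp
  have e2 : ENNReal.ofReal (2 * Real.pi) ^ n • torusMeasure n = Measure.pi
      fun _ : Fin n => ENNReal.ofReal (2 * Real.pi) • (AddCircle.haarAddCircle (T := 1)) := by
    symm
    refine Measure.pi_eq fun s _ => ?_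
    simp [torusMeasure, Measure.pi_pi, Finset.prod_mul_distrib]
  rw [e1, e2]
  exact h

theorem polar_lintegral (n : ℕ) (f : (Fin n → ℂ) → ℝ≥0∞) (hf : Measurable f) :
    ∫⁻ z, f z = ENNReal.ofReal (2 * Real.pi) ^ n *
      ∫⁻ θ, (∫⁻ r in {r : Fin n → ℝ | ∀ k, 0 < r k},
        (∏ k, ENNReal.ofReal (r k)) * f (polarMap n (θ, r))) ∂torusMeasure n := by
  rw [← Complex.lintegral_comp_pi_polarCoord_symm]
  have hm : Measurable fun x : UnitAddTorus (Fin n) × (Fin n → ℝ) =>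
      (∏ k, ENNReal.ofReal (x.2 k)) * f (polarMap n x) := by
    have := (continuous_polarMap n).measurable
    fun_prop
  have hpos : MeasurableSet {r : Fin n → ℝ | ∀ k, 0 < r k} := by measurability
  have hbox : MeasurableSet {φ : Fin n → ℝ | ∀ k, φ k ∈ Ioo (-Real.pi) Real.pi} := by
    measurability
  have hang := (angle_mp n).measurable
  have key : (∫⁻ p in (univ.pi fun _ : Fin n => Complex.polarCoord.target),
      (∏ i, ENNReal.ofReal (p i).1) * f (fun i => Complex.polarCoord.symm (p i)))
      = ∫⁻ y in {r : Fin n → ℝ | ∀ k, 0 < r k} ×ˢ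
          {φ : Fin n → ℝ | ∀ k, φ k ∈ Ioo (-Real.pi) Real.pi},
        (∏ k, ENNReal.ofReal (y.1 k)) * f (polarMap n (angleMap n y.2, y.1)) := by
    rw [← (volume_measurePreserving_arrowProdEquivProdArrow ℝ ℝ (Fin n)).setLIntegral_comp_preimage_emb
      (MeasurableEquiv.measurableEmbedding _)]
    have e : (MeasurableEquiv.arrowProdEquivProdArrow ℝ ℝ (Fin n)) ⁻¹'
        ({r : Fin n → ℝ | ∀ k, 0 < r k} ×ˢ
          {φ : Fin n → ℝ | ∀ k, φ k ∈ Ioo (-Real.pi) Real.pi})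
        = univ.pi fun _ : Fin n => Complex.polarCoord.target := by
      ext p
      simp only [mem_preimage, mem_prod, mem_pi, mem_univ, true_imp_iff,
        Complex.polarCoord_target, mem_Ioi]
      exact forall_and.symm
    rw [e]
    refine lintegral_congr fun p => ?_
    congr 2
    ext k
    simp only [Complex.polarCoord_symm_apply, polarMap, angleMap, AddCircle.toCircle_apply_mk,
      Circle.coe_exp]
    rw [mul_comm]
    congr 1
    have h : 2 * Real.pi / 1 * ((p k).2 / (2 * Real.pi)) = (p k).2 := by
      field_simp
    change _ = Complex.exp (((2 * Real.pi / 1 * ((p k).2 / (2 * Real.pi)) : ℝ) : ℂ) * Complex.I)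
    rw [h, Complex.exp_mul_I, Complex.ofReal_cos, Complex.ofReal_sin]
  rw [key, Measure.volume_eq_prod, ← Measure.prod_restrict, lintegral_prod_symm]
  · rw [← smul_eq_mul, ← lintegral_smul_measure,
      ← (angle_mp n).lintegral_comp]
    exact hm.lintegral_prod_right'
  · have : Measurable fun y : (Fin n → ℝ) × (Fin n → ℝ) => (angleMap n y.2, y.1) := by fun_prop
    exact (hm.comp this).aemeasurable

theorem measurePreserving_polarMap (n m : ℕ) :
    MeasurePreserving (polarMap n) ((torusMeasure n).prod (mu n m)) (nuAffine n m) := by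
  have hc := (continuous_polarMap n).measurable
  refine ⟨hc, Measure.ext_of_lintegral _ fun f hf => ?_⟩
  have hpos : MeasurableSet {r : Fin n → ℝ | ∀ k, 0 < r k} := by measurability
  rw [lintegral_map hf hc, lintegral_prod (fun x => f (polarMap n x)) (hf.comp hc).aemeasurable, nuAffine,
    lintegral_withDensity_eq_lintegral_mul _ (by fun_prop) hf, polar_lintegral _ _ (by fun_prop),
    ← lintegral_const_mul' _ _ (by finiteness)]
  refine lintegral_congr fun θ => ?_
  rw [mu, lintegral_withDensity_eq_lintegral_mul _ (by fun_prop) (by fun_prop),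
    ← lintegral_const_mul' _ _ (by finiteness)]
  refine setLIntegral_congr_fun hpos fun r hr => ?_
  simp only [Pi.mul_apply]
  have e : ∀ k, ‖polarMap n (θ, r) k‖ ^ 2 = r k ^ 2 := fun k => by
    simp only [polarMap, norm_mul, Circle.norm_coe, one_mul, Complex.norm_real, Real.norm_eq_abs,
      sq_abs]
  simp only [e]
  rw [← mul_assoc, ← mul_assoc, ← ENNReal.ofReal_prod_of_nonneg (fun k _ => (hr k).le),
    ← ENNReal.ofReal_pow (by positivity), ← ENNReal.ofReal_mul (by positivity),
    ← ENNReal.ofReal_mul (mul_nonneg (by positivity) (Finset.prod_nonneg fun k _ => (hr k).le))]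
  congr 2
  have : (1 + ∑ k, r k ^ 2) ≠ 0 := by positivity
  field_simp
  rw [mul_pow]
  ring

/-- An element of `L_2(ℂ^n, ν_m)` in polar coordinates. -/
def angularPolar (n m : ℕ) :
    Lp ℂ 2 (nuAffine n m) →ₗᵢ[ℂ] Lp ℂ 2 ((torusMeasure n).prod (mu n m)) :=
  Lp.compMeasurePreservingₗᵢ ℂ (polarMap n) (measurePreserving_polarMap n m)

theorem lintegral_sq_eq {α : Type*} [MeasurableSpace α] {ρ : Measure α} (f : Lp ℂ 2 ρ) :
    ∫⁻ x, ‖f x‖ₑ ^ 2 ∂ρ = ENNReal.ofReal (‖f‖ ^ 2) := by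
  rw [Lp.norm_def, ← ENNReal.toReal_pow, ENNReal.ofReal_toReal (by
    have := Lp.eLpNorm_ne_top f; finiteness),
    eLpNorm_eq_lintegral_rpow_enorm_toReal (by norm_num) (by norm_num), ← ENNReal.rpow_natCast,
    ← ENNReal.rpow_mul]
  simp

theorem coeff_aesm {n m : ℕ} (g : Lp ℂ 2 ((torusMeasure n).prod (mu n m))) (p : Fin n → ℤ) :
    AEStronglyMeasurable (fun r => UnitAddTorus.mFourierCoeff (fun θ => g (θ, r)) p) (mu n m) := by
  have h : AEStronglyMeasurable
      (fun x : (Fin n → ℝ) × UnitAddTorus (Fin n) =>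
        UnitAddTorus.mFourier (-p) x.2 • g (x.2, x.1)) ((mu n m).prod (torusMeasure n)) := by
    have hc : Continuous fun x : (Fin n → ℝ) × UnitAddTorus (Fin n) =>
      UnitAddTorus.mFourier (-p) x.2 := by fun_prop
    exact hc.aestronglyMeasurable.smul (Lp.aestronglyMeasurable g).prod_swap
  exact h.integral_prod_right'

theorem ae_slice_memLp {n m : ℕ} (g : Lp ℂ 2 ((torusMeasure n).prod (mu n m))) :
    ∀ᵐ r ∂mu n m, MemLp (fun θ => g (θ, r)) 2 (torusMeasure n) := by
  have h1 : AEStronglyMeasurable (fun x : (Fin n → ℝ) × UnitAddTorus (Fin n) => g (x.2, x.1))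
      ((mu n m).prod (torusMeasure n)) := (Lp.aestronglyMeasurable g).prod_swap
  have h2 : ∫⁻ r, ∫⁻ θ, ‖g (θ, r)‖ₑ ^ 2 ∂torusMeasure n ∂mu n m ≠ ∞ := by
    rw [← lintegral_prod_symm _ ((Lp.aestronglyMeasurable g).enorm.pow_const 2), lintegral_sq_eq]
    finiteness
  have h3 := ae_lt_top' (h1.enorm.pow_const 2).lintegral_prod_right' h2
  filter_upwards [h1.prodMk_left, h3] with r hr1 hr2
  refine ⟨hr1, ?_⟩
  rw [eLpNorm_lt_top_iff_lintegral_rpow_enorm_lt_top (by norm_num) (by norm_num)]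
  simpa using hr2

theorem tsum_sq_coeff {n : ℕ} {h : UnitAddTorus (Fin n) → ℂ} (hh : MemLp h 2 (torusMeasure n)) :
    ∑' p, ‖UnitAddTorus.mFourierCoeff h p‖ₑ ^ 2 = ∫⁻ θ, ‖h θ‖ₑ ^ 2 ∂torusMeasure n := by
  have key := UnitAddTorus.hasSum_sq_mFourierCoeff (d := Fin n) (hh.toLp h)
  have e1 : ∀ p, UnitAddTorus.mFourierCoeff (hh.toLp h) p = UnitAddTorus.mFourierCoeff h p := by
    intro p
    refine integral_congr_ae ?_
    filter_upwards [hh.coeFn_toLp] with θ hθ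
    rw [hθ]
  have e2 : ∫ θ, ‖(hh.toLp h) θ‖ ^ 2 ∂torusMeasure n = ∫ θ, ‖h θ‖ ^ 2 ∂torusMeasure n := by
    refine integral_congr_ae ?_
    filter_upwards [hh.coeFn_toLp] with θ hθ
    rw [hθ]
  have key' : HasSum (fun p => ‖UnitAddTorus.mFourierCoeff h p‖ ^ 2)
      (∫ θ, ‖h θ‖ ^ 2 ∂torusMeasure n) := by
    rw [← e2]
    exact key.congr_fun fun p => by rw [← e1]; rfl
  have e3 : ∀ x : ℂ, ‖x‖ₑ ^ 2 = ENNReal.ofReal (‖x‖ ^ 2) := fun x => by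
    rw [ENNReal.ofReal_pow (norm_nonneg _), ofReal_norm]
  simp only [e3]
  rw [← ENNReal.ofReal_tsum_of_nonneg (fun p => by positivity) key'.summable, key'.tsum_eq,
    ofReal_integral_eq_lintegral_ofReal]
  · exact hh.integrable_norm_pow (by norm_num)
  · exact Filter.Eventually.of_forall fun θ => by positivity

theorem tsum_lintegral_coeff {n m : ℕ} (g : Lp ℂ 2 ((torusMeasure n).prod (mu n m))) :
    ∑' p, ∫⁻ r, ‖UnitAddTorus.mFourierCoeff (fun θ => g (θ, r)) p‖ₑ ^ 2 ∂mu n m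
      = ENNReal.ofReal (‖g‖ ^ 2) := by
  rw [← lintegral_tsum fun p => (coeff_aesm g p).enorm.pow_const 2, ← lintegral_sq_eq,
    lintegral_prod_symm _ ((Lp.aestronglyMeasurable g).enorm.pow_const 2)]
  refine lintegral_congr_ae ?_
  filter_upwards [ae_slice_memLp g] with r hr
  exact tsum_sq_coeff hr

theorem coeff_memLp {n m : ℕ} (g : Lp ℂ 2 ((torusMeasure n).prod (mu n m))) (p : Fin n → ℤ) :
    MemLp (fun r => UnitAddTorus.mFourierCoeff (fun θ => g (θ, r)) p) 2 (mu n m) := by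
  refine ⟨coeff_aesm g p, ?_⟩
  rw [eLpNorm_lt_top_iff_lintegral_rpow_enorm_lt_top (by norm_num) (by norm_num)]
  have h1 := ENNReal.le_tsum (f := fun p => ∫⁻ r, ‖UnitAddTorus.mFourierCoeff
    (fun θ => g (θ, r)) p‖ₑ ^ 2 ∂mu n m) p
  rw [tsum_lintegral_coeff] at h1
  simpa using h1.trans_lt ENNReal.ofReal_lt_top

/-- The `p`-th Fourier coefficient in the angular variables: the function
`r ↦ ∫ g(t, r) t^(-p) dt` on the positive orthant. -/
def angularCoeff {n m : ℕ} (g : Lp ℂ 2 ((torusMeasure n).prod (mu n m))) (p : Fin n → ℤ) :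
    Lp ℂ 2 (mu n m) :=
  (coeff_memLp g p).toLp fun r => UnitAddTorus.mFourierCoeff (fun θ => g (θ, r)) p

theorem hasSum_angularCoeff {n m : ℕ} (g : Lp ℂ 2 ((torusMeasure n).prod (mu n m))) :
    HasSum (fun p => ‖angularCoeff g p‖ ^ 2) (‖g‖ ^ 2) := by
  have h : ∀ p, ENNReal.ofReal (‖angularCoeff g p‖ ^ 2)
      = ∫⁻ r, ‖UnitAddTorus.mFourierCoeff (fun θ => g (θ, r)) p‖ₑ ^ 2 ∂mu n m := by
    intro p
    rw [← lintegral_sq_eq]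
    refine lintegral_congr_ae ?_
    filter_upwards [(coeff_memLp g p).coeFn_toLp] with r hr
    rw [angularCoeff, hr]
  have h2 : ∑' p, ENNReal.ofReal (‖angularCoeff g p‖ ^ 2) = ENNReal.ofReal (‖g‖ ^ 2) := by
    simp only [h, tsum_lintegral_coeff]
  have h3 := ENNReal.hasSum_toReal (f := fun p => ENNReal.ofReal (‖angularCoeff g p‖ ^ 2))
    (by rw [h2]; finiteness)
  rw [← ENNReal.tsum_toReal_eq (by finiteness), h2] at h3
  simpa using h3

theorem ae_slice {n m : ℕ} {P : UnitAddTorus (Fin n) × (Fin n → ℝ) → Prop}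
    (h : ∀ᵐ x ∂(torusMeasure n).prod (mu n m), P x) :
    ∀ᵐ r ∂mu n m, ∀ᵐ θ ∂torusMeasure n, P (θ, r) :=
  Measure.ae_ae_of_ae_prod (Measure.measurePreserving_swap.quasiMeasurePreserving.ae h)

theorem integrable_slice {n : ℕ} {h : UnitAddTorus (Fin n) → ℂ}
    (hh : MemLp h 2 (torusMeasure n)) (p : Fin n → ℤ) :
    Integrable (fun θ => UnitAddTorus.mFourier (-p) θ • h θ) (torusMeasure n) := by
  refine (hh.integrable (by norm_num)).bdd_mul (c := 1)
    (UnitAddTorus.mFourier (-p)).continuous.aestronglyMeasurable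
    (Filter.Eventually.of_forall fun θ => ?_)
  exact (ContinuousMap.norm_coe_le_norm _ θ).trans UnitAddTorus.mFourier_norm.le

theorem angularCoeff_add {n m : ℕ} (f g : Lp ℂ 2 ((torusMeasure n).prod (mu n m)))
    (p : Fin n → ℤ) : angularCoeff (f + g) p = angularCoeff f p + angularCoeff g p := by
  rw [angularCoeff, angularCoeff, angularCoeff, ← MemLp.toLp_add]
  refine MemLp.toLp_congr _ _ ?_
  filter_upwards [ae_slice_memLp f, ae_slice_memLp g, ae_slice (Lp.coeFn_add f g)]
    with r h1 h2 h3
  refine Eq.trans ?_ (integral_add (integrable_slice h1 p) (integrable_slice h2 p))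
  refine integral_congr_ae ?_
  filter_upwards [h3] with θ hθ
  rw [hθ, Pi.add_apply, smul_add]

theorem angularCoeff_smul {n m : ℕ} (c : ℂ) (g : Lp ℂ 2 ((torusMeasure n).prod (mu n m)))
    (p : Fin n → ℤ) : angularCoeff (c • g) p = c • angularCoeff g p := by
  rw [angularCoeff, angularCoeff, ← MemLp.toLp_const_smul]
  refine MemLp.toLp_congr _ _ ?_
  filter_upwards [ae_slice (Lp.coeFn_smul c g)] with r h3
  refine Eq.trans ?_ (integral_smul c _)
  refine integral_congr_ae ?_
  filter_upwards [h3] with θ hθ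
  rw [hθ, Pi.smul_apply, smul_comm]

/-- The Fourier transform in the angular variables, as families indexed by `ℤ^n`; that is, the
discrete Fourier transform tensored with the identity. The space `l_2(ℤ^n) ⊗ L_2(μ_m)` is realized as
the square-summable families of elements of `L_2(μ_m)`. -/
def angularFourier (n m : ℕ) : Lp ℂ 2 ((torusMeasure n).prod (mu n m)) →ₗᵢ[ℂ]
    lp (fun _ : Fin n → ℤ => Lp ℂ 2 (mu n m)) 2 where
  toFun g := ⟨angularCoeff g, memℓp_gen (by simpa using (hasSum_angularCoeff g).summable)⟩
  map_add' f g := lp.ext (funext fun p => angularCoeff_add f g p)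
  map_smul' c g := lp.ext (funext fun p => angularCoeff_smul c g p)
  norm_map' g := by
    have h := lp.norm_rpow_eq_tsum (p := 2) (by norm_num)
      (⟨angularCoeff g, memℓp_gen (by simpa using (hasSum_angularCoeff g).summable)⟩ :
        lp (fun _ : Fin n → ℤ => Lp ℂ 2 (mu n m)) 2)
    simp only [ENNReal.toReal_ofNat, Real.rpow_ofNat, (hasSum_angularCoeff g).tsum_eq] at h
    exact (sq_eq_sq₀ (norm_nonneg _) (norm_nonneg _)).1 h

/-- The operator `U` on `L_2(P^n(ℂ), ν_m)`: pass to the affine chart `0`, then to polar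
coordinates, then apply the Fourier transform in the angular variables. -/
def U (n m : ℕ) : Lp ℂ 2 (nu n m) →L[ℂ] lp (fun _ : Fin n → ℤ => Lp ℂ 2 (mu n m)) 2 :=
  (((angularFourier n m).comp (angularPolar n m)).comp (Phi n m)).toContinuousLinearMap

/-- The multi-indices of total degree at most `m`. -/
def J (n m : ℕ) : Set (Fin n → ℕ) := {p | ∑ k, p k ≤ m}

theorem finite_J (n m : ℕ) : (J n m).Finite := by
  refine (Set.finite_Iic (fun _ : Fin n => m)).subset fun p hp k => ?_
  exact (Finset.single_le_sum (fun i _ => Nat.zero_le (p i)) (Finset.mem_univ k)).trans hp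

instance (n m : ℕ) : Fintype (J n m) := (finite_J n m).fintype

/-- The normalizing constant `(m! / (p! (m - |p|)!))^(1/2)`, for `p` in `J n m`. -/
def alpha {n : ℕ} (m : ℕ) (p : Fin n → ℕ) : ℝ :=
  Real.sqrt ((m.factorial : ℝ) /
    ((∏ k, ((p k).factorial : ℝ)) * ((m - ∑ k, p k).factorial : ℝ)))

theorem monomial_bound {n m : ℕ} {p : Fin n → ℕ} (hp : p ∈ J n m) {r : Fin n → ℝ}
    (hr : ∀ k, 0 < r k) :
    (∏ k, r k ^ p k) ^ 2 * ((1 + ∑ k, r k ^ 2) ^ (n + m + 1))⁻¹ * ∏ k, r k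
      ≤ (1 + ‖r‖ ^ 2) ^ (-((n : ℝ) + 2) / 2) := by
  set S : ℝ := 1 + ∑ k, r k ^ 2 with hS
  have hS1 : 1 ≤ S := by have : 0 ≤ ∑ k, r k ^ 2 := by positivity
                         linarith
  have hk : ∀ k, r k ^ 2 ≤ S := fun k => by
    have := Finset.single_le_sum (f := fun k => r k ^ 2) (fun i _ => sq_nonneg (r i))
      (Finset.mem_univ k)
    linarith
  have h1 : (∏ k, r k ^ p k) ^ 2 ≤ S ^ m := by
    calc (∏ k, r k ^ p k) ^ 2 = ∏ k, (r k ^ 2) ^ p k := by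
          rw [← Finset.prod_pow]
          exact Finset.prod_congr rfl fun k _ => by rw [← pow_mul, ← pow_mul, mul_comm]
      _ ≤ ∏ k, S ^ p k := Finset.prod_le_prod (fun k _ => by positivity)
          fun k _ => pow_le_pow_left₀ (sq_nonneg _) (hk k) _
      _ = S ^ ∑ k, p k := by rw [Finset.prod_pow_eq_pow_sum]
      _ ≤ S ^ m := pow_le_pow_right₀ hS1 hp
  have h2 : ∏ k, r k ≤ S ^ ((n : ℝ) / 2) := by
    calc ∏ k, r k ≤ ∏ _k : Fin n, S ^ ((1 : ℝ) / 2) := by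
          refine Finset.prod_le_prod (fun k _ => (hr k).le) fun k _ => ?_
          rw [← Real.sqrt_eq_rpow]
          exact Real.le_sqrt_of_sq_le (hk k)
      _ = S ^ ((n : ℝ) / 2) := by
          rw [Finset.prod_const, Finset.card_univ, Fintype.card_fin, ← Real.rpow_natCast,
            ← Real.rpow_mul (by linarith)]
          congr 1
          ring
  have h3 : 1 + ‖r‖ ^ 2 ≤ S := by
    have h0 : 0 ≤ ∑ k, r k ^ 2 := by positivity
    have : ‖r‖ ≤ Real.sqrt (∑ k, r k ^ 2) := by
      refine (pi_norm_le_iff_of_nonneg (Real.sqrt_nonneg _)).2 fun k => ?_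
      rw [Real.norm_eq_abs]
      exact Real.abs_le_sqrt (Finset.single_le_sum (f := fun k => r k ^ 2)
        (fun i _ => sq_nonneg (r i)) (Finset.mem_univ k))
    have := (Real.le_sqrt (norm_nonneg r) h0).1 this
    linarith
  have h4 : 0 ≤ ∏ k, r k := Finset.prod_nonneg fun k _ => (hr k).le
  calc _ ≤ S ^ m * (S ^ (n + m + 1))⁻¹ * S ^ ((n : ℝ) / 2) := by gcongr
    _ = S ^ (-((n : ℝ) + 2) / 2) := by
      have : (0 : ℝ) < S := by linarith
      rw [← Real.rpow_natCast, ← Real.rpow_natCast, ← Real.rpow_neg this.le,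
        ← Real.rpow_add this, ← Real.rpow_add this]
      congr 1
      push_cast
      ring
    _ ≤ _ := Real.rpow_le_rpow_of_nonpos (by positivity) h3 (by linarith [(n.cast_nonneg : (0:ℝ) ≤ n)])

theorem monomial_memLp {n m : ℕ} {p : Fin n → ℕ} (hp : p ∈ J n m) :
    MemLp (fun r : Fin n → ℝ => ∏ k, (r k : ℂ) ^ p k) 2 (mu n m) := by
  refine ⟨(by fun_prop : Continuous fun r : Fin n → ℝ =>
    ∏ k, (r k : ℂ) ^ p k).aestronglyMeasurable, ?_⟩
  have hpos : MeasurableSet {r : Fin n → ℝ | ∀ k, 0 < r k} := by measurability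
  rw [eLpNorm_lt_top_iff_lintegral_rpow_enorm_lt_top (by norm_num) (by norm_num), mu,
    lintegral_withDensity_eq_lintegral_mul _ (by fun_prop) (by fun_prop)]
  set C : ℝ := 2 ^ n * ((n + m).factorial : ℝ) / (m.factorial : ℝ) with hC
  have hint : Integrable (fun r : Fin n → ℝ => C * (1 + ‖r‖ ^ 2) ^ (-((n : ℝ) + 2) / 2))
      volume :=
    (integrable_rpow_neg_one_add_norm_sq (by simp)).const_mul C
  refine lt_of_le_of_lt ?_ hint.lintegral_lt_top
  refine (setLIntegral_mono' hpos fun r hr => ?_).trans (setLIntegral_le_lintegral _ _)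
  have e : ‖∏ k, (r k : ℂ) ^ p k‖ₑ ^ (2 : ℝ≥0∞).toReal
      = ENNReal.ofReal ((∏ k, r k ^ p k) ^ 2) := by
    rw [ENNReal.toReal_ofNat, ENNReal.rpow_ofNat, ← ofReal_norm,
      ← ENNReal.ofReal_pow (norm_nonneg _)]
    congr 1
    rw [norm_prod, ← Finset.prod_pow, ← Finset.prod_pow]
    exact Finset.prod_congr rfl fun k _ => by simp [abs_of_pos (hr k)]
  simp only [Pi.mul_apply]
  rw [e, ← ENNReal.ofReal_mul (mul_nonneg (by positivity)
    (Finset.prod_nonneg fun k _ => (hr k).le))]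
  refine ENNReal.ofReal_le_ofReal ?_
  refine le_trans (le_of_eq ?_) (mul_le_mul_of_nonneg_left (monomial_bound hp hr)
    (by positivity : 0 ≤ C))
  rw [div_eq_mul_inv]
  ring

/-- The radial monomial `r^p`, as an element of `L_2(μ_m)`. -/
def radialMonomial {n m : ℕ} (p : J n m) : Lp ℂ 2 (mu n m) :=
  (monomial_memLp p.2).toLp fun r => ∏ k, (r k : ℂ) ^ p.1 k

/-- The operator `R_0`: the `p`-th component of `R_0 c` is `alpha_p c_p r^p` for `p` in `J n m`, and
the components at all other elements of `ℤ^n` vanish. -/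
def R0 (n m : ℕ) :
    EuclideanSpace ℂ (J n m) →L[ℂ] lp (fun _ : Fin n → ℤ => Lp ℂ 2 (mu n m)) 2 :=
  ∑ p : J n m,
    (lp.singleContinuousLinearMap ℂ (fun _ : Fin n → ℤ => Lp ℂ 2 (mu n m)) 2
      (fun k => (p.1 k : ℤ))).comp
      ((EuclideanSpace.proj p).smulRight ((alpha m p.1 : ℂ) • radialMonomial p))

/-- The operator `R = R_0^* U`. -/
def R (n m : ℕ) : Lp ℂ 2 (nu n m) →L[ℂ] EuclideanSpace ℂ (J n m) :=
  (ContinuousLinearMap.adjoint (R0 n m)).comp (U n m)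

/-- The Bergman integral operator in the affine chart `0`, with the kernel
`(1 + ∑ z_k conj(w_k))^m`. -/
def bergmanIntegral {n m : ℕ} (ψ : Lp ℂ 2 (nu n m)) (z : Fin n → ℂ) : ℂ :=
  ∫ w, Phi n m ψ w * (1 + ∑ k, z k * star (w k)) ^ m ∂nuAffine n m

end
end SepRadial

open MeasureTheory Set
open scoped ENNReal

namespace SepRadial
noncomputable section

/-! Everything rests on the monomials `z^p` with `|p| ≤ m`, and on two facts about them.

They span the Bergman space. A holomorphic section of `H^m` is bounded in each trivialization on the
closed unit polydisc, and these polydiscs cover projective space. The transition factors `w_j^m`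
then bound its affine expression by a multiple of `max 1 ‖z‖ ^ m`, and Cauchy's estimates make it a
polynomial of degree at most `m`. Conversely, such a monomial, homogenized to degree `m`, is a
global section (`mem_bergmanSpace_iff`).

They diagonalize `U`. In polar coordinates `z^p = t^p r^p`, so `U` places the radial monomial `r^p`
in component `p` and zero elsewhere (`angularFourier_affineMonomial`). A Dirichlet integral shows
that `alpha_p r^p` has norm one (`norm_radialMonomial_sq`). Hence `R_0` sends the standard basis to
an orthonormal family, which is also the image under `U` of the vectors `alpha_p z^p`.

The rest is formal. Orthonormality gives `R_0^* R_0 = I`, and the isometry of `U` gives `U^* U = I`;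
so `R^* = U^* R_0` sends the basis vector `e_p` to `alpha_p z^p`, its range is the Bergman space,
and `R R^* = I`. Thus `R^*` is isometric and `R^* R` is the orthogonal projection onto its range.
The kernel appears because `∑ alpha_p^2 z^p conj(w)^p` is the multinomial expansion of `(1 + ∑ z_k
conj(w_k))^m`. -/

/-! ### Gamma and Dirichlet integrals; norms of the radial monomials -/

theorem lintegral_pow_mul_exp_neg_mul (N : ℕ) {b : ℝ} (hb : 0 < b) :
    ∫⁻ s in Ioi (0 : ℝ), ENNReal.ofReal (s ^ N * Real.exp (-(b * s)))
      = ENNReal.ofReal (N.factorial / b ^ (N + 1)) := by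
  have hN : (-1 : ℝ) < N := by linarith [(N.cast_nonneg : (0 : ℝ) ≤ N)]
  have h1 := integral_rpow_mul_exp_neg_mul_rpow (p := 1) (q := N) one_pos hN hb
  have h2 := integrableOn_rpow_mul_exp_neg_mul_rpow (p := 1) (s := N) hN one_pos hb
  simp only [Real.rpow_natCast, Real.rpow_one, div_one, mul_one, Real.Gamma_nat_eq_factorial,
    neg_mul, Real.rpow_neg hb.le] at h1 h2
  rw [← ofReal_integral_eq_lintegral_ofReal h2, h1]
  · rw [← Nat.cast_succ, Real.rpow_natCast, div_eq_inv_mul]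
  · exact (ae_restrict_mem measurableSet_Ioi).mono fun s (hs : 0 < s) => by positivity

theorem integrable_odd_pow_mul_exp_neg_mul_sq (a : ℕ) {s : ℝ} (hs : 0 < s) :
    Integrable (fun x : ℝ => x ^ (2 * a + 1) * Real.exp (-(s * x ^ 2)))
      (volume.restrict (Ioi 0)) := by
  have ha : (-1 : ℝ) < (2 * a + 1 : ℕ) := by
    linarith [((2 * a + 1).cast_nonneg : (0 : ℝ) ≤ (2 * a + 1 : ℕ))]
  have h2 := integrableOn_rpow_mul_exp_neg_mul_rpow (p := 2) (s := (2 * a + 1 : ℕ)) ha two_pos hs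
  simpa only [IntegrableOn, Real.rpow_natCast, Real.rpow_ofNat, neg_mul] using h2

theorem integral_odd_pow_mul_exp_neg_mul_sq (a : ℕ) {s : ℝ} (hs : 0 < s) :
    ∫ x in Ioi (0 : ℝ), x ^ (2 * a + 1) * Real.exp (-(s * x ^ 2))
      = a.factorial / 2 / s ^ (a + 1) := by
  have ha : (-1 : ℝ) < (2 * a + 1 : ℕ) := by
    linarith [((2 * a + 1).cast_nonneg : (0 : ℝ) ≤ (2 * a + 1 : ℕ))]
  have h1 := integral_rpow_mul_exp_neg_mul_rpow (p := 2) (q := (2 * a + 1 : ℕ)) two_pos ha hs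
  simp only [Real.rpow_natCast, Real.rpow_ofNat, neg_mul] at h1
  rw [h1]
  have e : (((2 * a + 1 : ℕ) : ℝ) + 1) / 2 = a + 1 := by push_cast; ring
  rw [neg_div, e, Real.Gamma_nat_eq_factorial, Real.rpow_neg hs.le, ← Nat.cast_succ,
    Real.rpow_natCast, Nat.succ_eq_add_one]
  field_simp

theorem restrict_orthant (n : ℕ) :
    (volume : Measure (Fin n → ℝ)).restrict {r | ∀ k, 0 < r k}
      = Measure.pi fun _ => volume.restrict (Ioi 0) := by
  have e : {r : Fin n → ℝ | ∀ k, 0 < r k} = univ.pi fun _ => Ioi 0 := by ext; simp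
  rw [e, volume_pi, Measure.restrict_pi_pi]

theorem lintegral_orthant_prod {n : ℕ} (p : Fin n → ℕ) {s : ℝ} (hs : 0 < s) :
    ∫⁻ r in {r : Fin n → ℝ | ∀ k, 0 < r k},
        ENNReal.ofReal (∏ k, (r k ^ (2 * p k + 1) * Real.exp (-(s * r k ^ 2))))
      = ENNReal.ofReal (∏ k, ((p k).factorial / 2 / s ^ (p k + 1) : ℝ)) := by
  have hpos : MeasurableSet {r : Fin n → ℝ | ∀ k, 0 < r k} := by measurability
  rw [← ofReal_integral_eq_lintegral_ofReal]
  · rw [restrict_orthant, integral_fintype_prod_eq_prod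
      (fun k x => x ^ (2 * p k + 1) * Real.exp (-(s * x ^ 2)))]
    simp only [integral_odd_pow_mul_exp_neg_mul_sq _ hs]
  · rw [restrict_orthant]
    exact Integrable.fintype_prod_dep
      (f := fun k x => x ^ (2 * p k + 1) * Real.exp (-(s * x ^ 2)))
      fun k => integrable_odd_pow_mul_exp_neg_mul_sq (p k) hs
  · filter_upwards [ae_restrict_mem hpos] with r hr
    exact Finset.prod_nonneg fun k _ => mul_nonneg (pow_nonneg (hr k).le _) (Real.exp_pos _).le

/-- The Dirichlet type integral of `r^(2p+1) / (1 + |r|^2)^(|p|+q+n+1)` over the positive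
orthant. -/
theorem lintegral_orthant_dirichlet {n : ℕ} (p : Fin n → ℕ) (q : ℕ) :
    ∫⁻ r in {r : Fin n → ℝ | ∀ k, 0 < r k},
        ENNReal.ofReal ((∏ k, r k ^ (2 * p k + 1)) / (1 + ∑ k, r k ^ 2) ^ (n + (∑ k, p k + q) + 1))
      = ENNReal.ofReal ((∏ k, ((p k).factorial : ℝ)) * q.factorial /
          (2 ^ n * (n + (∑ k, p k + q)).factorial)) := by
  set N := n + (∑ k, p k + q) with hN
  have hpos : MeasurableSet {r : Fin n → ℝ | ∀ k, 0 < r k} := by measurability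
  have hf : (0 : ℝ) < N.factorial := by positivity
  -- Writing `N! / (1 + |r|^2)^(N+1)` as the Gamma integral of `s^N exp(-(1 + |r|^2) s)` decouples
  -- the variables `r_k`. With values in `ℝ≥0∞`, Tonelli needs no integrability.
  have key : ∀ r ∈ {r : Fin n → ℝ | ∀ k, 0 < r k},
      ENNReal.ofReal ((∏ k, r k ^ (2 * p k + 1)) / (1 + ∑ k, r k ^ 2) ^ (N + 1))
      = ∫⁻ s in Ioi (0 : ℝ), ENNReal.ofReal (s ^ N * Real.exp (-s) / N.factorial) *
          ENNReal.ofReal (∏ k, (r k ^ (2 * p k + 1) * Real.exp (-(s * r k ^ 2)))) := by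
    intro r hr
    have hS : 0 < 1 + ∑ k, r k ^ 2 := by positivity
    have hP : 0 ≤ ∏ k, r k ^ (2 * p k + 1) :=
      Finset.prod_nonneg fun k _ => pow_nonneg (hr k).le _
    have e1 : (∏ k, r k ^ (2 * p k + 1)) / (1 + ∑ k, r k ^ 2) ^ (N + 1)
        = (∏ k, r k ^ (2 * p k + 1)) / N.factorial
          * (N.factorial / (1 + ∑ k, r k ^ 2) ^ (N + 1)) := by
      field_simp
    rw [e1, ENNReal.ofReal_mul (by positivity), ← lintegral_pow_mul_exp_neg_mul N hS,
      ← lintegral_const_mul' _ _ (by finiteness)]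
    refine setLIntegral_congr_fun measurableSet_Ioi fun s (hs : 0 < s) => ?_
    rw [← ENNReal.ofReal_mul (by positivity), ← ENNReal.ofReal_mul (by positivity)]
    congr 1
    rw [Finset.prod_mul_distrib, ← Real.exp_sum]
    have e2 : Real.exp (-((1 + ∑ k, r k ^ 2) * s))
        = Real.exp (-s) * Real.exp (∑ k, -(s * r k ^ 2)) := by
      rw [← Real.exp_add, Finset.sum_neg_distrib, ← Finset.mul_sum]
      congr 1
      ring
    rw [e2]
    ring
  rw [setLIntegral_congr_fun hpos key, lintegral_lintegral_swap (by fun_prop)]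
  -- The Gaussian integrals produce `s^(-(|p| + n))`. Since `N = n + |p| + q`, exactly `s^q exp(-s)`
  -- remains, whose integral is `q!`.
  have step : ∀ s ∈ Ioi (0 : ℝ),
      ∫⁻ r in {r : Fin n → ℝ | ∀ k, 0 < r k},
        ENNReal.ofReal (s ^ N * Real.exp (-s) / N.factorial) *
          ENNReal.ofReal (∏ k, (r k ^ (2 * p k + 1) * Real.exp (-(s * r k ^ 2))))
      = ENNReal.ofReal ((∏ k, ((p k).factorial : ℝ)) / (2 ^ n * N.factorial)) *
          ENNReal.ofReal (s ^ q * Real.exp (-(1 * s))) := by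
    intro s (hs : 0 < s)
    rw [lintegral_const_mul' _ _ (by finiteness), lintegral_orthant_prod p hs,
      ← ENNReal.ofReal_mul (by positivity), ← ENNReal.ofReal_mul (by positivity)]
    congr 1
    have e3 : ∏ k, s ^ (p k + 1) = s ^ (∑ k, p k) * s ^ n := by
      rw [Finset.prod_pow_eq_pow_sum, Finset.sum_add_distrib, pow_add]
      simp
    rw [Finset.prod_div_distrib, Finset.prod_div_distrib, e3, Finset.prod_const, Finset.card_univ,
      Fintype.card_fin, one_mul]
    have e4 : s ^ N = s ^ n * s ^ (∑ k, p k) * s ^ q := by rw [hN]; ring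
    rw [e4]
    field_simp
  rw [setLIntegral_congr_fun measurableSet_Ioi step, lintegral_const_mul' _ _ (by finiteness),
    lintegral_pow_mul_exp_neg_mul q one_pos, ← ENNReal.ofReal_mul (by positivity)]
  congr 1
  rw [one_pow]
  ring

theorem alpha_sq {n : ℕ} (m : ℕ) (p : Fin n → ℕ) :
    alpha m p ^ 2 = (m.factorial : ℝ) /
      ((∏ k, ((p k).factorial : ℝ)) * ((m - ∑ k, p k).factorial : ℝ)) :=
  Real.sq_sqrt (by positivity)

/-- The Dirichlet integral with `q = m - |p|` has the exponent `n + m + 1` of the weight, and its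
factor `2^n (n+m)!` cancels against the normalization of `mu`. -/
theorem norm_radialMonomial_sq {n m : ℕ} (p : J n m) :
    ‖radialMonomial p‖ ^ 2 = (alpha m p.1 ^ 2)⁻¹ := by
  have hpos : MeasurableSet {r : Fin n → ℝ | ∀ k, 0 < r k} := by measurability
  have h0 : ENNReal.ofReal (‖radialMonomial p‖ ^ 2) = ENNReal.ofReal ((alpha m p.1 ^ 2)⁻¹) := by
    have hq : ∑ k, p.1 k + (m - ∑ k, p.1 k) = m := Nat.add_sub_cancel' p.2
    have hd := lintegral_orthant_dirichlet p.1 (m - ∑ k, p.1 k)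
    rw [hq] at hd
    have e0 : (alpha m p.1 ^ 2)⁻¹ = (2 ^ n * ((n + m).factorial : ℝ) / (m.factorial : ℝ)) *
        ((∏ k, ((p.1 k).factorial : ℝ)) * (m - ∑ k, p.1 k).factorial /
          (2 ^ n * (n + m).factorial)) := by
      rw [alpha_sq]
      field_simp
    rw [e0, ENNReal.ofReal_mul (by positivity), ← hd, ← lintegral_const_mul' _ _ (by finiteness),
      ← lintegral_sq_eq]
    have e1 : ∫⁻ r, ‖radialMonomial p r‖ₑ ^ 2 ∂mu n m
        = ∫⁻ r, ‖∏ k, (r k : ℂ) ^ p.1 k‖ₑ ^ 2 ∂mu n m := by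
      refine lintegral_congr_ae ?_
      filter_upwards [(monomial_memLp p.2).coeFn_toLp] with r hr
      rw [radialMonomial, hr]
    rw [e1, mu, lintegral_withDensity_eq_lintegral_mul _ (by fun_prop) (by fun_prop)]
    refine setLIntegral_congr_fun hpos fun r hr => ?_
    have e : ‖∏ k, (r k : ℂ) ^ p.1 k‖ₑ ^ 2 = ENNReal.ofReal (∏ k, r k ^ (2 * p.1 k)) := by
      rw [← ofReal_norm, ← ENNReal.ofReal_pow (norm_nonneg _)]
      congr 1
      rw [norm_prod, ← Finset.prod_pow]
      refine Finset.prod_congr rfl fun k _ => ?_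
      rw [norm_pow, Complex.norm_real, Real.norm_eq_abs, abs_of_pos (hr k), ← pow_mul, mul_comm]
    simp only [Pi.mul_apply]
    have hP : 0 ≤ ∏ k, r k := Finset.prod_nonneg fun k _ => (hr k).le
    rw [e, ← ENNReal.ofReal_mul (by positivity), ← ENNReal.ofReal_mul (by positivity)]
    congr 1
    simp only [pow_succ _ (2 * _), Finset.prod_mul_distrib]
    ring
  exact (ENNReal.ofReal_eq_ofReal_iff (by positivity) (by positivity)).1 h0

theorem alpha_pos {n : ℕ} (m : ℕ) (p : Fin n → ℕ) : 0 < alpha m p := by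
  unfold alpha
  positivity

theorem norm_alpha_smul_radialMonomial {n m : ℕ} (p : J n m) :
    ‖(alpha m p.1 : ℂ) • radialMonomial p‖ = 1 := by
  have ha := alpha_pos m p.1
  have h : ‖(alpha m p.1 : ℂ) • radialMonomial p‖ ^ 2 = 1 ^ 2 := by
    rw [norm_smul, mul_pow, norm_radialMonomial_sq, Complex.norm_real, Real.norm_eq_abs, sq_abs]
    field_simp
  exact (sq_eq_sq₀ (norm_nonneg _) zero_le_one).1 h

/-! ### Liouville's theorem for polynomial growth -/

/-- An entire function of one variable of polynomial growth is a polynomial. -/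
theorem exists_polynomial_of_growth {g : ℂ → ℂ} (hg : Differentiable ℂ g) {C : ℝ} {m : ℕ}
    (hC : ∀ z, ‖g z‖ ≤ C * max 1 ‖z‖ ^ m) :
    ∃ Q : Polynomial ℂ, Q.natDegree ≤ m ∧ ∀ z, g z = Q.eval z := by
  have hz : ∀ k, m < k → iteratedDeriv k g 0 = 0 := by
    intro k hk
    -- Cauchy's estimate on the circle of radius `r` gives `k! C r^m / r^k`, which is at most `k! C
    -- / r` because `k ≥ m + 1`; then `r` tends to infinity.
    have hb : ∀ r : ℝ, 1 ≤ r → ‖iteratedDeriv k g 0‖ ≤ k.factorial * C / r := by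
      intro r hr
      have hr0 : 0 < r := by linarith
      have hC0 : 0 ≤ C := by
        have := (norm_nonneg _).trans (hC 0)
        simpa using this
      have h := Complex.norm_iteratedDeriv_le_of_forall_mem_sphere_norm_le (f := g) (c := 0)
        (C := C * r ^ m) k hr0 hg.diffContOnCl fun z hz => by
          have hz' : ‖z‖ = r := by simpa using hz
          have := hC z
          rwa [hz', max_eq_right hr] at this
      refine h.trans ?_
      rw [div_le_div_iff₀ (by positivity) hr0]
      have : r ^ m * r ≤ r ^ k := by
        rw [← pow_succ]
        exact pow_le_pow_right₀ hr hk
      calc k.factorial * (C * r ^ m) * r = k.factorial * C * (r ^ m * r) := by ring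
        _ ≤ _ := by gcongr
    have hlim : Filter.Tendsto (fun r : ℝ => k.factorial * C / r) Filter.atTop (nhds 0) :=
      Filter.tendsto_id.const_div_atTop _
    have := ge_of_tendsto hlim (Filter.eventually_atTop.2 ⟨1, hb⟩)
    exact norm_le_zero_iff.1 this
  refine ⟨∑ k ∈ Finset.range (m + 1),
    Polynomial.monomial k ((k.factorial : ℂ)⁻¹ * iteratedDeriv k g 0), ?_, fun z => ?_⟩
  · refine Polynomial.natDegree_sum_le_of_forall_le _ _ fun k hk => ?_
    exact (Polynomial.natDegree_monomial_le _).trans (Nat.lt_succ_iff.1 (Finset.mem_range.1 hk))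
  · rw [← Complex.taylorSeries_eq_of_entire' 0 z hg, tsum_eq_sum (s := Finset.range (m + 1))]
    · simp [Polynomial.eval_finsetSum, Polynomial.eval_monomial]
    · intro k hk
      rw [hz k (by simpa using hk)]
      simp

/-- An entire function of several variables of polynomial growth is a polynomial. -/
theorem exists_mvPolynomial_of_growth {n : ℕ} {f : (Fin n → ℂ) → ℂ} (hf : Differentiable ℂ f)
    {C : ℝ} {m : ℕ} (hC : ∀ z, ‖f z‖ ≤ C * max 1 ‖z‖ ^ m) :
    ∃ P : MvPolynomial (Fin n) ℂ, ∀ z, f z = MvPolynomial.eval z P := by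
  induction n generalizing C with
  | zero => exact ⟨MvPolynomial.C (f 0), fun z => by simp [Subsingleton.elim z 0]⟩
  | succ n ih =>
    have hC0 : 0 ≤ C := by
      have := (norm_nonneg _).trans (hC 0)
      simpa using this
    -- Bounding the maximum by a product separates the variables: each slice then has growth of the
    -- same order `m`, with a constant that depends on the frozen variable.
    have hcons : ∀ (x : ℂ) (y : Fin n → ℂ),
        max 1 ‖(Fin.cons x y : Fin (n + 1) → ℂ)‖ ≤ max 1 ‖x‖ * max 1 ‖y‖ := by
      intro x y
      have hx : 1 ≤ max 1 ‖x‖ := le_max_left _ _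
      have hy : 1 ≤ max 1 ‖y‖ := le_max_left _ _
      refine max_le (one_le_mul_of_one_le_of_one_le hx hy) ?_
      refine (pi_norm_le_iff_of_nonneg (by positivity)).2 fun k => ?_
      refine Fin.cases ?_ (fun k => ?_) k
      · rw [Fin.cons_zero]
        exact (le_max_right 1 ‖x‖).trans (le_mul_of_one_le_right (by positivity) hy)
      · rw [Fin.cons_succ]
        exact ((norm_le_pi_norm y k).trans (le_max_right 1 ‖y‖)).trans
          (le_mul_of_one_le_left (by positivity) hx)
    have hbd : ∀ (x : ℂ) (y : Fin n → ℂ), ‖f (Fin.cons x y)‖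
        ≤ C * max 1 ‖x‖ ^ m * max 1 ‖y‖ ^ m := by
      intro x y
      calc ‖f (Fin.cons x y)‖ ≤ C * max 1 ‖(Fin.cons x y : Fin (n + 1) → ℂ)‖ ^ m := hC _
        _ ≤ C * (max 1 ‖x‖ * max 1 ‖y‖) ^ m := by gcongr; exact hcons x y
        _ = _ := by rw [mul_pow]; ring
    have hd : Differentiable ℂ fun q : ℂ × (Fin n → ℂ) => f (Fin.cons q.1 q.2) := by
      refine hf.comp (differentiable_pi.2 fun k => ?_)
      refine Fin.cases ?_ (fun k => ?_) k
      · simp only [Fin.cons_zero]; fun_prop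
      · simp only [Fin.cons_succ]; fun_prop
    have hslice : ∀ x : ℂ, ∃ P : MvPolynomial (Fin n) ℂ,
        ∀ y, f (Fin.cons x y) = MvPolynomial.eval y P := fun x =>
      ih (f := fun y => f (Fin.cons x y))
        (hd.comp ((differentiable_const x).prodMk differentiable_id)) (hbd x)
    choose P hP using hslice
    have hinj : Set.InjOn (fun k : ℕ => (k : ℂ)) (Finset.range (m + 1) : Set ℕ) :=
      Nat.cast_injective.injOn
    -- For fixed `y`, the function `x ↦ f (x, y)` is a polynomial of degree at most `m`, so it is
    -- the Lagrange interpolant of its values at the nodes `0, ..., m`. By induction these values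
    -- are polynomials in `y`.
    refine ⟨∑ k ∈ Finset.range (m + 1),
      Polynomial.aeval (MvPolynomial.X 0)
        (Lagrange.basis (Finset.range (m + 1)) (fun k : ℕ => (k : ℂ)) k) *
        MvPolynomial.rename Fin.succ (P (k : ℂ)), fun z => ?_⟩
    obtain ⟨x, y, rfl⟩ : ∃ x y, z = Fin.cons x y := ⟨z 0, Fin.tail z, (Fin.cons_self_tail z).symm⟩
    obtain ⟨Q, hQ, hQe⟩ := exists_polynomial_of_growth (g := fun x => f (Fin.cons x y))
      (C := C * max 1 ‖y‖ ^ m) (m := m)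
      (hd.comp (differentiable_id.prodMk (differentiable_const y)))
      (fun x => (hbd x y).trans (le_of_eq (by ring)))
    have hdeg : Q.degree < (Finset.range (m + 1)).card := by
      rw [Finset.card_range]
      exact (Polynomial.degree_le_natDegree).trans_lt (by exact_mod_cast Nat.lt_succ_of_le hQ)
    have hx := hQe x
    rw [hx, Lagrange.eq_interpolate hinj hdeg, Lagrange.interpolate_apply,
      Polynomial.eval_finsetSum, map_sum]
    refine Finset.sum_congr rfl fun k _ => ?_
    rw [Polynomial.eval_mul, Polynomial.eval_C, ← hQe, map_mul, MvPolynomial.eval_rename, hP]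
    have e1 : (Fin.cons x y : Fin (n + 1) → ℂ) ∘ Fin.succ = y := by ext; simp
    have e2 : ∀ B : Polynomial ℂ, MvPolynomial.eval (Fin.cons x y : Fin (n + 1) → ℂ)
        (Polynomial.aeval (MvPolynomial.X 0) B) = B.eval x := fun B => by
      rw [← MvPolynomial.coe_aeval_eq_eval, RingHom.coe_coe, ← Polynomial.aeval_algHom_apply]
      simp
    rw [e1, e2, mul_comm]

theorem eval_smul_of_isHomogeneous {σ : Type*} [Fintype σ] {P : MvPolynomial σ ℂ} {j : ℕ}
    (hP : P.IsHomogeneous j) (t : ℂ) (z : σ → ℂ) :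
    MvPolynomial.eval (t • z) P = t ^ j * MvPolynomial.eval z P := by
  rw [MvPolynomial.eval_eq', MvPolynomial.eval_eq', Finset.mul_sum]
  refine Finset.sum_congr rfl fun d hd => ?_
  have hj : ∑ k, d k = j := by
    rw [← Finsupp.degree_eq_sum, Finsupp.degree_eq_weight_one]
    exact hP (MvPolynomial.mem_support_iff.1 hd)
  simp only [Pi.smul_apply, smul_eq_mul, mul_pow, Finset.prod_mul_distrib,
    Finset.prod_pow_eq_pow_sum, hj]
  ring

/-- Along a complex line `t ↦ t z`, the coefficient of `t^k` is the value at `z` of the component of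
degree `k`. The restriction grows at most like `|t|^m`, so this coefficient vanishes for `k > m`. -/
theorem homogeneousComponent_eq_zero_of_growth {n : ℕ} {P : MvPolynomial (Fin n) ℂ} {C : ℝ}
    {m : ℕ} (hC : ∀ z, ‖MvPolynomial.eval z P‖ ≤ C * max 1 ‖z‖ ^ m) {k : ℕ} (hk : m < k) :
    MvPolynomial.homogeneousComponent k P = 0 := by
  have hC0 : 0 ≤ C := by
    have := (norm_nonneg _).trans (hC 0)
    simpa using this
  refine MvPolynomial.funext fun z => ?_
  set L : Polynomial ℂ := ∑ j ∈ Finset.range (P.totalDegree + 1),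
    Polynomial.monomial j (MvPolynomial.eval z (MvPolynomial.homogeneousComponent j P)) with hL
  have hLe : ∀ t : ℂ, MvPolynomial.eval (t • z) P = L.eval t := by
    intro t
    conv_lhs => rw [← MvPolynomial.sum_homogeneousComponent P]
    rw [map_sum, hL, Polynomial.eval_finsetSum]
    refine Finset.sum_congr rfl fun j _ => ?_
    rw [Polynomial.eval_monomial,
      eval_smul_of_isHomogeneous (MvPolynomial.homogeneousComponent_isHomogeneous j P),
        mul_comm]
  obtain ⟨Q, hQ, hQe⟩ := exists_polynomial_of_growth (g := fun t => L.eval t)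
    (C := C * max 1 ‖z‖ ^ m) (m := m) L.differentiable (fun t => by
      rw [← hLe]
      refine (hC _).trans ?_
      have : max 1 ‖t • z‖ ≤ max 1 ‖z‖ * max 1 ‖t‖ := by
        have h1 : 1 ≤ max 1 ‖z‖ := le_max_left _ _
        have h2 : 1 ≤ max 1 ‖t‖ := le_max_left _ _
        refine max_le (one_le_mul_of_one_le_of_one_le h1 h2) ?_
        rw [norm_smul, mul_comm]
        gcongr <;> exact le_max_right _ _
      calc C * max 1 ‖t • z‖ ^ m ≤ C * (max 1 ‖z‖ * max 1 ‖t‖) ^ m := by gcongr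
        _ = _ := by rw [mul_pow]; ring)
  have hLQ : L = Q := Polynomial.funext hQe
  have hcoef : L.coeff k = 0 := by
    rw [hLQ]
    exact Polynomial.coeff_eq_zero_of_natDegree_lt (hQ.trans_lt hk)
  rw [map_zero]
  by_cases hkd : k ≤ P.totalDegree
  · rw [hL, Polynomial.finsetSum_coeff] at hcoef
    simpa [Polynomial.coeff_monomial, Nat.lt_succ_iff, hkd] using hcoef
  · rw [MvPolynomial.homogeneousComponent_eq_zero _ _ (not_le.1 hkd), map_zero]

/-- An entire function that grows at most like `‖z‖^m` is a linear combination of the monomials of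
total degree at most `m`. -/
theorem exists_sum_monomials_of_growth {n : ℕ} {f : (Fin n → ℂ) → ℂ} (hf : Differentiable ℂ f)
    {C : ℝ} {m : ℕ} (hC : ∀ z, ‖f z‖ ≤ C * max 1 ‖z‖ ^ m) :
    ∃ c : J n m → ℂ, ∀ z, f z = ∑ p : J n m, c p * ∏ k, z k ^ p.1 k := by
  classical
  obtain ⟨P, hP⟩ := exists_mvPolynomial_of_growth hf hC
  have hcoeff : ∀ d ∈ P.support, ⇑d ∈ J n m := by
    intro d hd
    by_contra hdm
    have hk : m < d.degree := by
      rw [Finsupp.degree_eq_sum]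
      exact not_le.1 hdm
    have h := homogeneousComponent_eq_zero_of_growth (P := P) (fun z => hP z ▸ hC z) hk
    have h2 := MvPolynomial.coeff_homogeneousComponent d.degree P d
    rw [h, if_pos rfl, MvPolynomial.coeff_zero] at h2
    exact MvPolynomial.mem_support_iff.1 hd h2.symm
  have h0 : (0 : Fin n → ℕ) ∈ J n m := by
    change ∑ _, 0 ≤ m
    simp
  refine ⟨fun p => P.coeff (Finsupp.equivFunOnFinite.symm p.1), fun z => ?_⟩
  rw [hP, MvPolynomial.eval_eq']
  -- The support of `P` embeds into `J n m`, and indices outside the image have coefficient zero.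
  -- The default index `0` is never taken on the support.
  refine Finset.sum_of_injOn (fun d => if h : ⇑d ∈ J n m then ⟨⇑d, h⟩ else ⟨0, h0⟩)
    ?_ ?_ ?_ ?_
  · intro d hd d' hd' h
    dsimp only at h
    rw [dif_pos (hcoeff d hd), dif_pos (hcoeff d' hd')] at h
    exact DFunLike.coe_injective (Subtype.mk.inj h)
  · intro d hd
    simp
  · intro p _ hp
    rw [mul_eq_zero]
    left
    by_contra hne
    refine hp ⟨Finsupp.equivFunOnFinite.symm p.1, MvPolynomial.mem_support_iff.2 hne, ?_⟩
    have : (⇑(Finsupp.equivFunOnFinite.symm p.1) : Fin n → ℕ) ∈ J n m := p.2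
    exact dif_pos this
  · intro d hd
    rw [dif_pos (hcoeff d hd)]
    simp

/-! ### Holomorphic sections of `H^m` and the monomials -/

/-- The transition rule between trivializations: `m`-linearity extracts the scalar `m` times. The
points `ℓ` and `ℓ'` are kept distinct because their fibres are different types until the equality is
substituted. -/
theorem section_apply_smul {n m : ℕ} (ζ : ∀ ℓ : PC n, HFiber m ℓ) {ℓ ℓ' : PC n} (h : ℓ' = ℓ)
    (v : ℓ.submodule) (v' : ℓ'.submodule) {a : ℂ}
    (hv : (v' : Fin (n + 1) → ℂ) = a • (v : Fin (n + 1) → ℂ)) :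
    ζ ℓ' (fun _ => v') = a ^ m * ζ ℓ (fun _ => v) := by
  subst h
  have e : v' = a • v := Subtype.ext hv
  rw [e]
  simpa using (ζ ℓ').map_smul_univ (fun _ => a) (fun _ => v)

/-- The affine expression of a holomorphic section of the `m`-th power of the hyperplane bundle
grows at most like `‖z‖^m`. -/
theorem IsHolomorphicSection.exists_growth {n m : ℕ} {ζ : ∀ ℓ : PC n, HFiber m ℓ}
    (hζ : IsHolomorphicSection ζ) :
    ∃ C : ℝ, ∀ z, ‖localForm ζ 0 z‖ ≤ C * max 1 ‖z‖ ^ m := by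
  have hb : ∀ j, ∃ B, ∀ y ∈ Metric.closedBall (0 : Fin n → ℂ) 1, ‖localForm ζ j y‖ ≤ B := fun j =>
    (isCompact_closedBall 0 1).exists_bound_of_continuousOn (hζ j).continuous.continuousOn
  choose B hB using hb
  have hB0 : ∀ j, 0 ≤ B j := fun j =>
    (norm_nonneg _).trans (hB j 0 (Metric.mem_closedBall_self zero_le_one))
  refine ⟨∑ j, B j, fun z => ?_⟩
  set w : Fin (n + 1) → ℂ := Fin.insertNth 0 1 z with hw
  -- Dividing by a homogeneous coordinate of largest modulus puts the point in the closed unit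
  -- polydisc of chart `j`, where the bound `B j` applies.
  obtain ⟨j, hj⟩ := Finite.exists_max fun k => ‖w k‖
  have hw0 : w 0 = 1 := by simp [hw]
  have hj1 : 1 ≤ ‖w j‖ := by simpa [hw0] using hj 0
  have ha : w j ≠ 0 := norm_pos_iff.1 (by linarith)
  have hjz : ‖w j‖ ≤ max 1 ‖z‖ := by
    refine Fin.cases ?_ (fun k => ?_) j
    · simp [hw0]
    · have : w k.succ = z k := by simp [hw]
      rw [this]
      exact (norm_le_pi_norm z k).trans (le_max_right _ _)
  set y : Fin n → ℂ := fun k => w (j.succAbove k) / w j with hy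
  have hwy : w = w j • (j.insertNth (1 : ℂ) y : Fin (n + 1) → ℂ) := by
    ext k
    refine Fin.succAboveCases j ?_ (fun k => ?_) k
    · simp
    · simp [hy, mul_div_cancel₀ _ ha]
  have hpt : chartInv 0 z = chartInv j y :=
    (Projectivization.mk_eq_mk_iff' ℂ _ _ _ _).2 ⟨w j, hwy.symm⟩
  have hyb : y ∈ Metric.closedBall (0 : Fin n → ℂ) 1 := by
    rw [mem_closedBall_zero_iff]
    refine (pi_norm_le_iff_of_nonneg zero_le_one).2 fun k => ?_
    rw [hy, norm_div]
    exact div_le_one_of_le₀ (hj _) (norm_nonneg _)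
  have e : localForm ζ 0 z = w j ^ m * localForm ζ j y :=
    section_apply_smul ζ hpt (frame j y) (frame 0 z) hwy
  rw [e, norm_mul, norm_pow, mul_comm]
  have : ‖localForm ζ j y‖ ≤ ∑ j, B j :=
    (hB j y hyb).trans (Finset.single_le_sum (fun i _ => hB0 i) (Finset.mem_univ j))
  gcongr
  exact Finset.sum_nonneg fun i _ => hB0 i

/-- A multi-index of degree `m` is unrolled into a list of `m` indices, `k` occurring `q k` times:
one linear factor for each slot of an `m`-linear form. -/
theorem exists_prod_index {M : Type*} [CommMonoid M] {N m : ℕ} (q : Fin N → ℕ)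
    (hq : ∑ k, q k = m) :
    ∃ i : Fin m → Fin N, ∀ w : Fin N → M, ∏ t, w (i t) = ∏ k, w k ^ q k := by
  subst hq
  refine ⟨fun t => (finSigmaFinEquiv.symm t).1, fun w => ?_⟩
  rw [Equiv.prod_comp finSigmaFinEquiv.symm (fun x : (k : Fin N) × Fin (q k) => w x.1),
    Fintype.prod_sigma]
  simp

/-- The section of the `m`-th power of the hyperplane bundle that multiplies the homogeneous
coordinates with indices `i t`. -/
def coordinateSection {n m : ℕ} (i : Fin m → Fin (n + 1)) (ℓ : PC n) : HFiber m ℓ :=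
  (MultilinearMap.mkPiAlgebra ℂ (Fin m) ℂ).compLinearMap fun t =>
    (LinearMap.proj (i t)).comp ℓ.submodule.subtype

theorem localForm_coordinateSection {n m : ℕ} (i : Fin m → Fin (n + 1)) (j : Fin (n + 1))
    (z : Fin n → ℂ) :
    localForm (coordinateSection i) j z
      = ∏ t, (j.insertNth (1 : ℂ) z : Fin (n + 1) → ℂ) (i t) := by
  simp [localForm, coordinateSection, frame]

theorem isHolomorphicSection_coordinateSection {n m : ℕ} (i : Fin m → Fin (n + 1)) :
    IsHolomorphicSection (coordinateSection i) := by
  intro j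
  have e : localForm (coordinateSection i) j
      = fun z => ∏ t, (j.insertNth (1 : ℂ) z : Fin (n + 1) → ℂ) (i t) :=
    funext fun z => localForm_coordinateSection i j z
  rw [e]
  have h : ∀ k : Fin (n + 1),
      Differentiable ℂ fun z : Fin n → ℂ => (j.insertNth (1 : ℂ) z : Fin (n + 1) → ℂ) k := by
    intro k
    refine Fin.succAboveCases j ?_ (fun k => ?_) k
    · simp
    · simp only [Fin.insertNth_apply_succAbove]
      fun_prop
  refine fun z => ?_
  exact (HasFDerivAt.finsetProd fun t _ => (h (i t) z).hasFDerivAt).differentiableAt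

/-- Homogenization: the missing degree `m - |p|` goes to the coordinate `w_0`, which equals `1` on
the frame of chart `0`. -/
theorem exists_section_monomial {n m : ℕ} (p : J n m) :
    ∃ ζ : ∀ ℓ : PC n, HFiber m ℓ, IsHolomorphicSection ζ ∧
      ∀ z, localForm ζ 0 z = ∏ k, z k ^ p.1 k := by
  obtain ⟨i, hi⟩ := exists_prod_index (M := ℂ) (m := m)
    (Fin.cons (m - ∑ k, p.1 k) p.1 : Fin (n + 1) → ℕ)
    (by rw [Fin.sum_cons]; exact Nat.sub_add_cancel p.2)
  refine ⟨coordinateSection i, isHolomorphicSection_coordinateSection i, fun z => ?_⟩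
  rw [localForm_coordinateSection, hi, Fin.prod_univ_succ]
  simp

/-- The Bergman space consists of the linear combinations of the monomials of degree at
most `m`. -/
theorem mem_bergmanSpace_iff {n m : ℕ} (f : Lp ℂ 2 (nu n m)) :
    f ∈ bergmanSpace n m ↔ ∃ c : J n m → ℂ,
      Phi n m f =ᵐ[nuAffine n m] fun z => ∑ p : J n m, c p * ∏ k, z k ^ p.1 k := by
  constructor
  · rintro ⟨ζ, hζ, hf⟩
    obtain ⟨C, hC⟩ := hζ.exists_growth
    obtain ⟨c, hc⟩ := exists_sum_monomials_of_growth (hζ 0) hC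
    exact ⟨c, hf.trans (Filter.Eventually.of_forall hc)⟩
  · rintro ⟨c, hc⟩
    choose ζ hζ hz using exists_section_monomial (n := n) (m := m)
    have e : ∀ j z, localForm (fun ℓ => ∑ p : J n m, c p • ζ p ℓ) j z
        = ∑ p : J n m, c p * localForm (ζ p) j z := fun j z => by
      simp [localForm]
    refine ⟨fun ℓ => ∑ p : J n m, c p • ζ p ℓ, fun j => ?_, hc.trans ?_⟩
    · rw [funext (e j)]
      exact Differentiable.fun_sum fun p _ => (hζ p j).const_mul (c p)
    · refine Filter.Eventually.of_forall fun z => ?_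
      simp only [e, hz]

/-! ### Inverting the affine chart up to null sets -/

/-- The affine coordinates of a point of projective space, with value `0` outside the chart. -/
def affineCoord {n : ℕ} (ℓ : PC n) : Fin n → ℂ := fun k => ℓ.rep k.succ / ℓ.rep 0

theorem affineCoord_mk {n : ℕ} (v : Fin (n + 1) → ℂ) (hv : v ≠ 0) :
    affineCoord (Projectivization.mk ℂ v hv) = fun k => v k.succ / v 0 := by
  obtain ⟨a, ha⟩ := Projectivization.exists_smul_eq_mk_rep ℂ v hv
  ext k
  rw [affineCoord, ← ha, Pi.smul_apply, Pi.smul_apply, Units.smul_def, Units.smul_def,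
    smul_eq_mul, smul_eq_mul, mul_div_mul_left _ _ a.ne_zero]

theorem affineCoord_chartInv {n : ℕ} (z : Fin n → ℂ) : affineCoord (chartInv 0 z) = z := by
  rw [chartInv, affineCoord_mk]
  simp

theorem isOpen_PC_iff {n : ℕ} {s : Set (PC n)} :
    IsOpen s ↔ IsOpen (Projectivization.mk' (V := Fin (n + 1) → ℂ) ℂ ⁻¹' s) :=
  isOpen_coinduced

/-- On the open set `w_0 ≠ 0` the map is continuous, as is checked on the quotient map. On the
complement it is constantly zero, since division by zero gives zero. -/
theorem measurable_affineCoord (n : ℕ) : Measurable (affineCoord (n := n)) := by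
  set V : Set (PC n) := {ℓ | ℓ.rep 0 ≠ 0} with hV
  have hVmem : ∀ v : {v : Fin (n + 1) → ℂ // v ≠ 0},
      Projectivization.mk' ℂ v ∈ V ↔ v.1 0 ≠ 0 := by
    intro v
    obtain ⟨a, ha⟩ := Projectivization.exists_smul_eq_mk_rep ℂ v.1 v.2
    rw [Projectivization.mk'_eq_mk, hV, mem_ofPred_eq, ← ha, Pi.smul_apply, Units.smul_def,
      smul_eq_mul]
    simp
  have hopen : ∀ T : Set (Fin n → ℂ), IsOpen T → IsOpen (affineCoord ⁻¹' T ∩ V) := by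
    intro T hT
    rw [isOpen_PC_iff]
    have e : Projectivization.mk' ℂ ⁻¹' (affineCoord ⁻¹' T ∩ V)
        = {v : {v : Fin (n + 1) → ℂ // v ≠ 0} | v.1 0 ≠ 0} ∩
          (fun v k => v.1 k.succ / v.1 0) ⁻¹' T := by
      ext v
      rw [preimage_inter, mem_inter_iff, mem_preimage (s := V), hVmem, mem_inter_iff, and_comm]
      refine and_congr_right fun _ => ?_
      rw [mem_preimage, mem_preimage, mem_preimage, Projectivization.mk'_eq_mk, affineCoord_mk]
    rw [e]
    have hcoord : ∀ k, Continuous fun v : {v : Fin (n + 1) → ℂ // v ≠ 0} => v.1 k := fun k =>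
      (continuous_apply k).comp continuous_subtype_val
    have h0 : IsOpen {v : {v : Fin (n + 1) → ℂ // v ≠ 0} | v.1 0 ≠ 0} :=
      isOpen_ne_fun (hcoord 0) continuous_const
    refine ContinuousOn.isOpen_inter_preimage ?_ h0 hT
    refine continuousOn_pi.2 fun k => ContinuousOn.div (hcoord _).continuousOn
      (hcoord _).continuousOn fun v hv => hv
  have hVm : MeasurableSet V := by
    have := hopen univ isOpen_univ
    rw [preimage_univ, univ_inter] at this
    exact this.measurableSet
  refine measurable_of_isOpen fun T hT => ?_
  have e : affineCoord ⁻¹' T = (affineCoord ⁻¹' T ∩ V) ∪ (affineCoord ⁻¹' T ∩ Vᶜ) :=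
    (inter_union_compl _ _).symm
  rw [e]
  refine (hopen T hT).measurableSet.union ?_
  have hz : ∀ ℓ ∈ Vᶜ, affineCoord ℓ = 0 := by
    intro ℓ hℓ
    have : ℓ.rep 0 = 0 := not_not.1 hℓ
    ext k
    simp [affineCoord, this]
  by_cases h0 : (0 : Fin n → ℂ) ∈ T
  · have : affineCoord ⁻¹' T ∩ Vᶜ = Vᶜ :=
      inter_eq_right.2 fun ℓ hℓ => by rw [mem_preimage, hz ℓ hℓ]; exact h0
    rw [this]
    exact hVm.compl
  · have : affineCoord ⁻¹' T ∩ Vᶜ = ∅ := by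
      refine eq_empty_of_forall_notMem fun ℓ hℓ => h0 ?_
      have := hℓ.1
      rwa [mem_preimage, hz ℓ hℓ.2] at this
    rw [this]
    exact MeasurableSet.empty

theorem measurePreserving_affineCoord (n m : ℕ) :
    MeasurePreserving affineCoord (nu n m) (nuAffine n m) := by
  refine ⟨measurable_affineCoord n, ?_⟩
  rw [nu, Measure.map_map (measurable_affineCoord n) (continuous_chartInv 0).measurable]
  have : affineCoord ∘ chartInv (n := n) 0 = id := funext affineCoord_chartInv
  rw [this, Measure.map_id]

/-- Composition with the measure-preserving left inverse `affineCoord` of the chart gives preimages.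
This is how affine monomials are lifted to projective space. -/
theorem Phi_surjective (n m : ℕ) : Function.Surjective (Phi n m) := by
  intro f
  refine ⟨Lp.compMeasurePreserving affineCoord (measurePreserving_affineCoord n m) f, ?_⟩
  refine Lp.ext ?_
  have h1 := Lp.coeFn_compMeasurePreserving f (measurePreserving_affineCoord n m)
  refine (Lp.coeFn_compMeasurePreserving _ (measurePreserving_chartInv n m)).trans ?_
  have h2 := (measurePreserving_chartInv n m).quasiMeasurePreserving.ae_eq_comp h1
  refine h2.trans (Filter.Eventually.of_forall fun z => ?_)
  simp [affineCoord_chartInv]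

/-! ### Angular Fourier transform of the monomials -/

theorem monomial_polarMap {n : ℕ} (p : Fin n → ℕ) (x : UnitAddTorus (Fin n) × (Fin n → ℝ)) :
    ∏ k, polarMap n x k ^ p k
      = UnitAddTorus.mFourier (fun k => (p k : ℤ)) x.1 * ∏ k, (x.2 k : ℂ) ^ p k := by
  simp only [polarMap, mul_pow, Finset.prod_mul_distrib]
  congr 1
  simp [UnitAddTorus.mFourier, fourier_apply, AddCircle.toCircle_nsmul]

/-- The modulus of `z^p` is independent of the angles, so in polar coordinates this reduces to the
radial monomial and a probability measure on the torus. -/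
theorem affineMonomial_memLp {n m : ℕ} (p : J n m) :
    MemLp (fun z : Fin n → ℂ => ∏ k, z k ^ p.1 k) 2 (nuAffine n m) := by
  have hc : Continuous fun z : Fin n → ℂ => ∏ k, z k ^ p.1 k := by fun_prop
  rw [← (measurePreserving_polarMap n m).map_eq, memLp_map_measure_iff
    hc.aestronglyMeasurable (continuous_polarMap n).aemeasurable]
  refine ((monomial_memLp p.2).comp_snd (torusMeasure n)).congr_norm
    (hc.comp (continuous_polarMap n)).aestronglyMeasurable
    (Filter.Eventually.of_forall fun x => ?_)
  simp only [Function.comp_apply, polarMap, norm_prod, norm_pow, norm_mul, Circle.norm_coe, one_mul]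

/-- The monomial `z^p`, as an element of `L_2(ℂ^n, ν_m)`. -/
def affineMonomial {n m : ℕ} (p : J n m) : Lp ℂ 2 (nuAffine n m) :=
  (affineMonomial_memLp p).toLp fun z => ∏ k, z k ^ p.1 k

theorem mFourierCoeff_mFourier_mul {n : ℕ} (p q : Fin n → ℤ) (c : ℂ) :
    UnitAddTorus.mFourierCoeff (fun θ => UnitAddTorus.mFourier p θ * c) q
      = if q = p then c else 0 := by
  classical
  have h : UnitAddTorus.mFourierCoeff (UnitAddTorus.mFourier p) q = if q = p then 1 else 0 := by
    have h1 := UnitAddTorus.mFourierBasis_repr (UnitAddTorus.mFourierLp 2 p) q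
    rw [UnitAddTorus.mFourierCoeff_toLp] at h1
    rw [← h1, ← UnitAddTorus.coe_mFourierBasis, HilbertBasis.repr_self, lp.single_apply,
      Pi.single_apply]
  calc UnitAddTorus.mFourierCoeff (fun θ => UnitAddTorus.mFourier p θ * c) q
      = UnitAddTorus.mFourierCoeff (UnitAddTorus.mFourier p) q * c := by
        rw [UnitAddTorus.mFourierCoeff, UnitAddTorus.mFourierCoeff, ← integral_mul_const]
        simp only [smul_eq_mul, mul_assoc]
    _ = _ := by rw [h]; split_ifs <;> simp

/-- For almost every `r`, the angular slice of `z^p` is the constant `r^p` times the single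
character `t^p`, and characters are orthonormal. -/
theorem angularFourier_affineMonomial {n m : ℕ} (p : J n m) :
    angularFourier n m (angularPolar n m (affineMonomial p))
      = lp.single (E := fun _ : Fin n → ℤ => Lp ℂ 2 (mu n m)) 2 (fun k => (p.1 k : ℤ))
          (radialMonomial p) := by
  classical
  refine lp.ext (funext fun q => ?_)
  rw [lp.single_apply]
  change angularCoeff (angularPolar n m (affineMonomial p)) q = _
  have hg : angularPolar n m (affineMonomial p) =ᵐ[(torusMeasure n).prod (mu n m)]
      fun x => UnitAddTorus.mFourier (fun k => (p.1 k : ℤ)) x.1 * ∏ k, (x.2 k : ℂ) ^ p.1 k := by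
    refine (Lp.coeFn_compMeasurePreserving _ (measurePreserving_polarMap n m)).trans ?_
    refine ((measurePreserving_polarMap n m).quasiMeasurePreserving.ae_eq_comp
      (affineMonomial_memLp p).coeFn_toLp).trans ?_
    exact Filter.Eventually.of_forall fun x => monomial_polarMap p.1 x
  have hcoef : angularCoeff (angularPolar n m (affineMonomial p)) q =ᵐ[mu n m]
      fun r => if q = (fun k => (p.1 k : ℤ)) then ∏ k, (r k : ℂ) ^ p.1 k else 0 := by
    refine (coeff_memLp _ q).coeFn_toLp.trans ?_
    filter_upwards [ae_slice hg] with r hr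
    rw [← mFourierCoeff_mFourier_mul]
    refine integral_congr_ae ?_
    filter_upwards [hr] with θ hθ
    rw [hθ]
  refine Lp.ext (hcoef.trans ?_)
  by_cases hq : q = fun k => (p.1 k : ℤ)
  · subst hq
    rw [Pi.single_eq_same]
    simp only [if_true]
    exact (monomial_memLp p.2).coeFn_toLp.symm
  · rw [Pi.single_eq_of_ne hq]
    simp only [hq, if_false]
    exact (Lp.coeFn_zero _ _ _).symm

/-! ### The operators `R_0`, `U`, `R` on the monomial basis -/

theorem exists_basis_vector {n m : ℕ} (p : J n m) :
    ∃ f : Lp ℂ 2 (nu n m), Phi n m f = (alpha m p.1 : ℂ) • affineMonomial p :=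
  Phi_surjective n m _

/-- The normalized monomial `alpha_p z^p`, as an element of `L_2(P^n(ℂ), ν_m)`. -/
def basisVector {n m : ℕ} (p : J n m) : Lp ℂ 2 (nu n m) := (exists_basis_vector p).choose

theorem Phi_basisVector {n m : ℕ} (p : J n m) :
    Phi n m (basisVector p) = (alpha m p.1 : ℂ) • affineMonomial p :=
  (exists_basis_vector p).choose_spec

theorem Phi_sum_basisVector {n m : ℕ} (c : J n m → ℂ) :
    Phi n m (∑ p, c p • basisVector p) =ᵐ[nuAffine n m]
      fun z => ∑ p : J n m, c p * (alpha m p.1 : ℂ) * ∏ k, z k ^ p.1 k := by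
  have h : ∀ p : J n m, (c p • (alpha m p.1 : ℂ) • affineMonomial p : Lp ℂ 2 (nuAffine n m))
      =ᵐ[nuAffine n m] fun z => c p * (alpha m p.1 : ℂ) * ∏ k, z k ^ p.1 k := fun p => by
    rw [smul_smul]
    filter_upwards [Lp.coeFn_smul (c p * (alpha m p.1 : ℂ)) (affineMonomial p),
      (affineMonomial_memLp p).coeFn_toLp] with z h1 h2
    rw [h1, Pi.smul_apply, affineMonomial, h2, smul_eq_mul]
  simp only [map_sum, map_smul, Phi_basisVector]
  filter_upwards [Lp.coeFn_finsetSum Finset.univ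
    fun p : J n m => (c p • (alpha m p.1 : ℂ) • affineMonomial p : Lp ℂ 2 (nuAffine n m)),
    ae_all_iff.2 h] with z h1 h2
  rw [h1, Finset.sum_apply]
  exact Finset.sum_congr rfl fun p _ => h2 p

theorem R0_apply {n m : ℕ} (c : EuclideanSpace ℂ (J n m)) :
    R0 n m c = ∑ p : J n m, c p • lp.single (E := fun _ : Fin n → ℤ => Lp ℂ 2 (mu n m)) 2
      (fun k => (p.1 k : ℤ)) ((alpha m p.1 : ℂ) • radialMonomial p) := by
  rw [R0, sum_apply]
  exact Finset.sum_congr rfl fun p _ => lp.single_smul _ _ _ _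

/-- Distinct indices occupy distinct components of the direct sum, so only the normalization by
`alpha` requires a computation. -/
theorem orthonormal_single_radialMonomial (n m : ℕ) :
    Orthonormal ℂ fun p : J n m => lp.single (E := fun _ : Fin n → ℤ => Lp ℂ 2 (mu n m)) 2
      (fun k => (p.1 k : ℤ)) ((alpha m p.1 : ℂ) • radialMonomial p) := by
  refine ⟨fun p => ?_, fun p q hpq => ?_⟩
  · rw [lp.norm_single (by norm_num), norm_alpha_smul_radialMonomial]
  · dsimp only
    rw [lp.inner_single_left, lp.single_apply, Pi.single_eq_of_ne, inner_zero_right]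
    intro h
    refine hpq (Subtype.ext (funext fun k => ?_))
    exact_mod_cast congrFun h k

theorem adjoint_R0_comp_R0 (n m : ℕ) :
    (ContinuousLinearMap.adjoint (R0 n m)).comp (R0 n m) = ContinuousLinearMap.id ℂ _ := by
  refine ContinuousLinearMap.ext fun c => ext_inner_left ℂ fun d => ?_
  rw [ContinuousLinearMap.comp_apply, ContinuousLinearMap.adjoint_inner_right, R0_apply, R0_apply,
    (orthonormal_single_radialMonomial n m).inner_sum]
  simp [PiLp.inner_apply, mul_comm]

theorem adjoint_U_comp_U (n m : ℕ) :
    (ContinuousLinearMap.adjoint (U n m)).comp (U n m) = ContinuousLinearMap.id ℂ _ :=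
  (ContinuousLinearMap.norm_map_iff_adjoint_comp_self (U n m)).1 fun f =>
    (((angularFourier n m).comp (angularPolar n m)).comp (Phi n m)).norm_map f

/-- The link between the two sides: the range of `R_0` lies in the range of `U`. Therefore `U^* U =
I` suffices below, and `U` need not be onto. -/
theorem U_sum_basisVector {n m : ℕ} (c : EuclideanSpace ℂ (J n m)) :
    U n m (∑ p, c p • basisVector p) = R0 n m c := by
  rw [R0_apply, map_sum]
  refine Finset.sum_congr rfl fun p _ => ?_
  rw [map_smul]
  congr 1
  change angularFourier n m (angularPolar n m (Phi n m (basisVector p))) = _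
  rw [Phi_basisVector, map_smul, map_smul, angularFourier_affineMonomial, lp.single_smul]

theorem adjoint_R (n m : ℕ) :
    ContinuousLinearMap.adjoint (R n m)
      = (ContinuousLinearMap.adjoint (U n m)).comp (R0 n m) := by
  rw [R, ContinuousLinearMap.adjoint_comp, ContinuousLinearMap.adjoint_adjoint]

theorem adjoint_R_apply {n m : ℕ} (c : EuclideanSpace ℂ (J n m)) :
    ContinuousLinearMap.adjoint (R n m) c = ∑ p, c p • basisVector p := by
  rw [adjoint_R, ContinuousLinearMap.comp_apply, ← U_sum_basisVector]
  exact DFunLike.congr_fun (adjoint_U_comp_U n m) _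

theorem R_adjoint_R_apply {n m : ℕ} (c : EuclideanSpace ℂ (J n m)) :
    R n m (ContinuousLinearMap.adjoint (R n m) c) = c := by
  rw [adjoint_R_apply, R, ContinuousLinearMap.comp_apply, U_sum_basisVector]
  exact DFunLike.congr_fun (adjoint_R0_comp_R0 n m) c

theorem R_comp_adjoint_R (n m : ℕ) :
    (R n m).comp (ContinuousLinearMap.adjoint (R n m)) = ContinuousLinearMap.id ℂ _ :=
  ContinuousLinearMap.ext R_adjoint_R_apply

theorem norm_adjoint_R_apply {n m : ℕ} (c : EuclideanSpace ℂ (J n m)) :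
    ‖ContinuousLinearMap.adjoint (R n m) c‖ = ‖c‖ := by
  refine (ContinuousLinearMap.norm_map_iff_adjoint_comp_self _).2 ?_ c
  rw [ContinuousLinearMap.adjoint_adjoint]
  exact R_comp_adjoint_R n m

theorem Phi_adjoint_R_apply {n m : ℕ} (c : EuclideanSpace ℂ (J n m)) :
    Phi n m (ContinuousLinearMap.adjoint (R n m) c) =ᵐ[nuAffine n m]
      fun z => ∑ p : J n m, c p * (alpha m p.1 : ℂ) * ∏ k, z k ^ p.1 k := by
  rw [adjoint_R_apply]
  exact Phi_sum_basisVector _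

theorem mem_bergmanSpace_iff_exists_adjoint_R {n m : ℕ} (f : Lp ℂ 2 (nu n m)) :
    f ∈ bergmanSpace n m ↔ ∃ c, ContinuousLinearMap.adjoint (R n m) c = f := by
  rw [mem_bergmanSpace_iff]
  constructor
  · rintro ⟨c, hc⟩
    -- `R^*` multiplies the `p`-th coefficient by `alpha_p`, which is undone in advance.
    refine ⟨WithLp.toLp 2 fun p => c p / (alpha m p.1 : ℂ), (Phi n m).injective (Lp.ext ?_)⟩
    refine ((Phi_adjoint_R_apply _).trans (Filter.Eventually.of_forall fun z => ?_)).trans hc.symm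
    refine Finset.sum_congr rfl fun p _ => ?_
    have : (alpha m p.1 : ℂ) ≠ 0 := Complex.ofReal_ne_zero.2 (alpha_pos m p.1).ne'
    simp [this]
  · rintro ⟨c, rfl⟩
    exact ⟨_, Phi_adjoint_R_apply c⟩

/-- The adjoint of `R`, as an isometric isomorphism onto the Bergman space. -/
def bergmanEquiv (n m : ℕ) : EuclideanSpace ℂ (J n m) ≃ₗᵢ[ℂ] bergmanSpace n m :=
  LinearIsometryEquiv.ofSurjective
    ⟨(ContinuousLinearMap.adjoint (R n m)).toLinearMap.codRestrict (bergmanSpace n m) fun c =>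
      (mem_bergmanSpace_iff_exists_adjoint_R _).2 ⟨c, rfl⟩, norm_adjoint_R_apply⟩
    fun ψ => by
      obtain ⟨c, hc⟩ := (mem_bergmanSpace_iff_exists_adjoint_R _).1 ψ.2
      exact ⟨c, Subtype.ext hc⟩

theorem coe_bergmanEquiv {n m : ℕ} (c : EuclideanSpace ℂ (J n m)) :
    (bergmanEquiv n m c : Lp ℂ 2 (nu n m)) = ContinuousLinearMap.adjoint (R n m) c := rfl

theorem bergmanEquiv_symm_apply {n m : ℕ} (ψ : bergmanSpace n m) :
    (bergmanEquiv n m).symm ψ = R n m (ψ : Lp ℂ 2 (nu n m)) := by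
  obtain ⟨c, rfl⟩ := (bergmanEquiv n m).surjective ψ
  rw [LinearIsometryEquiv.symm_apply_apply, coe_bergmanEquiv, R_adjoint_R_apply]

instance (n m : ℕ) : FiniteDimensional ℂ (bergmanSpace n m) :=
  (bergmanEquiv n m).toLinearEquiv.finiteDimensional

/-- Every element of the Bergman space is some `R^* d`, and `⟨ψ - R^* R ψ, R^* d⟩` vanishes after
moving `R^*` across, because `R R^* = I`. -/
theorem adjoint_R_comp_R (n m : ℕ) :
    (ContinuousLinearMap.adjoint (R n m)).comp (R n m) = (bergmanSpace n m).starProjection := by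
  refine ContinuousLinearMap.ext fun ψ => ?_
  refine (Submodule.eq_starProjection_of_mem_of_inner_eq_zero
    ((mem_bergmanSpace_iff_exists_adjoint_R _).2 ⟨R n m ψ, rfl⟩) fun w hw => ?_).symm
  obtain ⟨d, rfl⟩ := (mem_bergmanSpace_iff_exists_adjoint_R _).1 hw
  rw [ContinuousLinearMap.adjoint_inner_right, map_sub,
    R_adjoint_R_apply, sub_self, inner_zero_left]

/-! ### The Bergman kernel -/

/-- The multinomial theorem in the `n + 1` variables `1, x_1, ..., x_n`. The exponent of `1` is
forced to be `m - |p|`, and `alpha_p^2` is the multinomial coefficient. -/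
theorem one_add_sum_pow {n : ℕ} (m : ℕ) (x : Fin n → ℂ) :
    (1 + ∑ k, x k) ^ m = ∑ p : J n m, (alpha m p.1 : ℂ) ^ 2 * ∏ k, x k ^ p.1 k := by
  have h := Finset.sum_pow_eq_sum_piAntidiag (Finset.univ : Finset (Fin (n + 1)))
    (Fin.cons 1 x : Fin (n + 1) → ℂ) m
  rw [Fin.sum_univ_succ] at h
  simp only [Fin.cons_zero, Fin.cons_succ] at h
  rw [h]
  have hsum : ∀ q ∈ Finset.piAntidiag (Finset.univ : Finset (Fin (n + 1))) m,
      q 0 + ∑ k, Fin.tail q k = m := fun q hq => by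
    rw [← (Finset.mem_piAntidiag.1 hq).1, Fin.sum_univ_succ]
    rfl
  refine Finset.sum_bij' (fun q hq => (⟨Fin.tail q, by
      have := hsum q hq
      change ∑ k, Fin.tail q k ≤ m
      omega⟩ : J n m))
    (fun p _ => (Fin.cons (m - ∑ k, p.1 k) p.1 : Fin (n + 1) → ℕ)) ?_ ?_ ?_ ?_ ?_
  · intro q hq
    exact Finset.mem_univ _
  · intro p _
    refine Finset.mem_piAntidiag.2 ⟨?_, fun _ _ => Finset.mem_univ _⟩
    rw [Fin.sum_cons]
    exact Nat.sub_add_cancel p.2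
  · intro q hq
    have e : m - ∑ k, Fin.tail q k = q 0 := by
      have := hsum q hq
      omega
    dsimp only
    rw [e, Fin.cons_self_tail]
  · intro p _
    exact Subtype.ext (Fin.tail_cons (α := fun _ => ℕ) (m - ∑ k, p.1 k) p.1)
  · intro q hq
    have e : m - ∑ k, Fin.tail q k = q 0 := by
      have := hsum q hq
      omega
    have hm := Nat.multinomial_spec (Finset.univ : Finset (Fin (n + 1))) q
    rw [(Finset.mem_piAntidiag.1 hq).1, Fin.prod_univ_succ] at hm
    rw [← Complex.ofReal_pow, alpha_sq]
    dsimp only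
    rw [e, ← hm, Fin.prod_univ_succ]
    simp only [Fin.cons_zero, one_pow, one_mul, Fin.cons_succ, Fin.tail]
    congr 1
    push_cast
    have h1 : ((q 0).factorial : ℂ) ≠ 0 := by exact_mod_cast (q 0).factorial_ne_zero
    have h2 : ∏ k : Fin n, ((q k.succ).factorial : ℂ) ≠ 0 :=
      Finset.prod_ne_zero_iff.2 fun k _ => by exact_mod_cast (q k.succ).factorial_ne_zero
    field_simp

/-- The `p`-th coordinate is the pairing with `R^* e_p`, which is the normalized monomial; `Phi`
preserves inner products. -/
theorem R_apply_eq_inner {n m : ℕ} (ψ : Lp ℂ 2 (nu n m)) (p : J n m) :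
    R n m ψ p = inner ℂ ((alpha m p.1 : ℂ) • affineMonomial p) (Phi n m ψ) := by
  classical
  have h : ContinuousLinearMap.adjoint (R n m) (EuclideanSpace.single p 1) = basisVector p := by
    rw [adjoint_R_apply, Finset.sum_eq_single p] <;> simp +contextual
  rw [← Phi_basisVector, LinearIsometry.inner_map_map, ← h,
    ContinuousLinearMap.adjoint_inner_left]
  simp [EuclideanSpace.inner_single_left]

theorem R_apply_eq_integral {n m : ℕ} (ψ : Lp ℂ 2 (nu n m)) (p : J n m) :
    R n m ψ p = (alpha m p.1 : ℂ) *
      ∫ w, Phi n m ψ w * ∏ k, star (w k) ^ p.1 k ∂nuAffine n m := by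
  rw [R_apply_eq_inner, inner_smul_left, Complex.conj_ofReal, L2.inner_def]
  congr 1
  refine integral_congr_ae ?_
  filter_upwards [(affineMonomial_memLp p).coeFn_toLp] with w hw
  rw [affineMonomial, hw]
  simp

theorem integrable_mul_star_monomial {n m : ℕ} (ψ : Lp ℂ 2 (nu n m)) (p : J n m) :
    Integrable (fun w => Phi n m ψ w * ∏ k, star (w k) ^ p.1 k) (nuAffine n m) := by
  refine (Lp.memLp (Phi n m ψ)).integrable_mul ((affineMonomial_memLp p).congr_norm
    (Continuous.aestronglyMeasurable (by fun_prop)) (Filter.Eventually.of_forall fun w => ?_))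
  simp

theorem Phi_adjoint_R_R {n m : ℕ} (ψ : Lp ℂ 2 (nu n m)) :
    Phi n m (ContinuousLinearMap.adjoint (R n m) (R n m ψ)) =ᵐ[nuAffine n m]
      bergmanIntegral ψ := by
  refine (Phi_adjoint_R_apply _).trans (Filter.Eventually.of_forall fun z => ?_)
  -- Expanding the kernel gives a finite sum that separates `z` from `w`. One factor `alpha_p`
  -- belongs to the coordinate of `R ψ`, the other to `R^*`.
  have e : ∀ w, Phi n m ψ w * (1 + ∑ k, z k * star (w k)) ^ m
      = ∑ p : J n m, (alpha m p.1 : ℂ) ^ 2 * (∏ k, z k ^ p.1 k) *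
        (Phi n m ψ w * ∏ k, star (w k) ^ p.1 k) := fun w => by
    rw [one_add_sum_pow, Finset.mul_sum]
    refine Finset.sum_congr rfl fun p _ => ?_
    simp only [mul_pow, Finset.prod_mul_distrib]
    ring
  simp only [bergmanIntegral, e]
  rw [integral_finsetSum _ fun p _ => (integrable_mul_star_monomial ψ p).const_mul _]
  refine Finset.sum_congr rfl fun p _ => ?_
  rw [integral_const_mul, R_apply_eq_integral]
  ring

end
end SepRadial

theorem mainTheorem2 (n m : ℕ) :
    -- `R` maps `L_2(P^n(ℂ), ν_m)` onto `l_2(J_n(m))`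
    Function.Surjective (SepRadial.R n m) ∧
    -- the restriction of `R` to the Bergman space is an isometric isomorphism onto `l_2(J_n(m))`
    (∃ e : SepRadial.bergmanSpace n m ≃ₗᵢ[ℂ] EuclideanSpace ℂ (SepRadial.J n m),
      ∀ ψ : SepRadial.bergmanSpace n m, e ψ = SepRadial.R n m (ψ : Lp ℂ 2 (SepRadial.nu n m))) ∧
    -- the adjoint is `U^* R_0`, an isometric isomorphism of `l_2(J_n(m))` onto the Bergman space
    ContinuousLinearMap.adjoint (SepRadial.R n m) =
      (ContinuousLinearMap.adjoint (SepRadial.U n m)).comp (SepRadial.R0 n m) ∧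
    (∃ e : EuclideanSpace ℂ (SepRadial.J n m) ≃ₗᵢ[ℂ] SepRadial.bergmanSpace n m,
      ∀ c, (e c : Lp ℂ 2 (SepRadial.nu n m)) =
        ContinuousLinearMap.adjoint (SepRadial.R n m) c) ∧
    -- `R R^* = I`
    (SepRadial.R n m).comp (ContinuousLinearMap.adjoint (SepRadial.R n m)) =
      ContinuousLinearMap.id ℂ (EuclideanSpace ℂ (SepRadial.J n m)) ∧
    -- `R^* R` is the orthogonal projection onto the Bergman space
    (∃ _ : (SepRadial.bergmanSpace n m).HasOrthogonalProjection,
      (ContinuousLinearMap.adjoint (SepRadial.R n m)).comp (SepRadial.R n m) =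
        (SepRadial.bergmanSpace n m).starProjection) ∧
    -- and it is given by integration against the Bergman kernel
    (∀ ψ : Lp ℂ 2 (SepRadial.nu n m),
      SepRadial.Phi n m (ContinuousLinearMap.adjoint (SepRadial.R n m) (SepRadial.R n m ψ))
        =ᵐ[SepRadial.nuAffine n m] SepRadial.bergmanIntegral ψ) := by
  refine ⟨fun c => ⟨_, SepRadial.R_adjoint_R_apply c⟩,
    ⟨(SepRadial.bergmanEquiv n m).symm, SepRadial.bergmanEquiv_symm_apply⟩,
    SepRadial.adjoint_R n m, ⟨SepRadial.bergmanEquiv n m, SepRadial.coe_bergmanEquiv⟩,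
    SepRadial.R_comp_adjoint_R n m, ⟨inferInstance, SepRadial.adjoint_R_comp_R n m⟩,
    SepRadial.Phi_adjoint_R_R⟩
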